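/- Conventions. For a $C^*$-algebra $B$ let $\mathcal M(B)$ be its multiplier algebra. A $*$-homomorphism $\varphi\colon A\to\mathcal M(B)$ is a \emph{morphism} from $A$ to $B$, written $\varphi\in\mathrm{Mor}(A,B)$, if $\operatorname{span}\{\varphi(a)b : a\in A,\ b\in B\}$ is norm-dense in $B$. An ideal of a $C^*$-algebra is a norm-closed two-sided ideal; for an ideal $I$ of $A$ put $I^\perp=\{a\in A : ab=0 \text{ for all } b\in I\}$. For $\varphi\in\mathrm{Mor}(A,B)$ let $\mathrm{pim}(\varphi)=\varphi^{-1}(B)$ and $\mathrm{kat}(\varphi)=\mathrm{pim}(\varphi)\cap\ker(\varphi)^\perp$; an ideal $J$ of $A$ is \emph{$\varphi$-proper} if $\varphi(J)\subseteq B$, and \emph{$\varphi$-perfect} if moreover $\varphi|_J$ is injective. For a right Hilbert $A$-module $X$ with inner product $\langle\cdot\mid\cdot\rangle_A$ let $\mathcal L_A(X)$ be the $C^*$-algebra of adjointable operators and $\mathcal K_A(X)=\overline{\operatorname{span}}\{\Theta_{x,y} : x,y\in X\}$, where $\Theta_{x,y}(z)=x\cdot\langle y\mid z\rangle_A$; identify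 $\mathcal L_A(X)$ with $\mathcal M(\mathcal K_A(X))$. The module $X$ is \emph{full} if $\overline{\operatorname{span}}\{\langle x\mid y\rangle_A : x,y\in X\}=A$. For an ideal $I$ of $A$ let $X\cdot I=\{x\cdot a : x\in X,\ a\in I\}$, and identify $\mathcal K_A(X\cdot I)$ with the ideal $\overline{\operatorname{span}}\{\Theta_{x,y} : x,y\in X\cdot I\}$ of $\mathcal K_A(X)$. A \emph{nondegenerate $A$--$B$-correspondence} $(\psi,Y_B)$ is a right Hilbert $B$-module $Y$ with a $*$-homomorphism $\psi\colon A\to\mathcal L_B(Y)$ such that $\operatorname{span}\{\psi(a)y : a\in A,\ y\in Y\}$ is dense in $Y$; then $\psi\in\mathrm{Mor}(A,\mathcal K_B(Y))$. Let $X\otimes_A Y$ be the interior tensor product, the right Hilbert $B$-module densely spanned by elementary tensors with $\langle x\otimes y\mid x'\otimes y'\rangle_B=\langle y\mid\psi(\langle x\mid x'\rangle_A)y'\rangle_B$. Proposition. Let $X$ be a full right Hilbert $A$-module and let $(\psi,Y_B)$ be a nondegenerate $A$--$B$-correspondence. Let $\lambda\colon\mathcal K_A(X)\to\mathcal L_B(X\otimes_A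 Y)\cong\mathcal M(\mathcal K_B(X\otimes_A Y))$, $\lambda(T)=T\otimes 1$, that is, $\lambda(T)(x\otimes y)=(Tx)\otimes y$. Then $\lambda\in\mathrm{Mor}(\mathcal K_A(X),\mathcal K_B(X\otimes_A Y))$, and 1. $\mathrm{pim}(\lambda)=\mathcal K_A(X\cdot\mathrm{pim}(\psi))$; 2. $\ker(\lambda)=\mathcal K_A(X\cdot\ker(\psi))$; 3. $\ker(\lambda)^\perp=\mathcal K_A(X\cdot\ker(\psi)^\perp)$; 4. $\mathrm{kat}(\lambda)=\mathcal K_A(X\cdot\mathrm{kat}(\psi))$. Moreover, the $\psi$-proper ideals, the $\psi$-perfect ideals, the $\lambda$-proper ideals and the $\lambda$-perfect ideals each form a sublattice of the ideal lattice of $A$, respectively of $\mathcal K_A(X)$; the map $I\mapsto\mathcal K_A(X\cdot I)$ induced by the Morita equivalence $X$ is an isomorphism from the lattice of ideals of $A$ onto the lattice of ideals of $\mathcal K_A(X)$; and it maps the set of $\psi$-proper ideals onto the set of $\lambda$-proper ideals and the set of $\psi$-perfect ideals onto the set of $\lambda$-perfect ideals. -/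

import Mathlib

set_option linter.unusedSectionVars false

open scoped MultiplierAlgebra TensorProduct
open MulOpposite

noncomputable section

namespace HilbertCorr

/-! ### Ideals of C*-algebras, morphisms into multiplier algebras -/

/-- An ideal of a C*-algebra: a norm-closed two-sided ideal. -/
structure ClosedIdeal (A : Type*) [NonUnitalCStarAlgebra A] extends Submodule ℂ A where
  mul_mem_left' : ∀ a {b : A}, b ∈ carrier → a * b ∈ carrier
  mul_mem_right' : ∀ {b : A} (a : A), b ∈ carrier → b * a ∈ carrier
  isClosed' : IsClosed carrier

section Ideals

variable {A B : Type*} [NonUnitalCStarAlgebra A] [NonUnitalCStarAlgebra B]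

namespace ClosedIdeal

instance : SetLike (ClosedIdeal A) A where
  coe I := I.carrier
  coe_injective I J h := by
    cases I; cases J
    congr 1
    exact SetLike.coe_injective h

/-- Ideals are ordered by inclusion. -/
instance : PartialOrder (ClosedIdeal A) := PartialOrder.ofSetLike (ClosedIdeal A) A

@[ext] theorem ext {I J : ClosedIdeal A} (h : ∀ a, a ∈ I ↔ a ∈ J) : I = J := SetLike.ext h

instance : InfSet (ClosedIdeal A) where
  sInf S :=
    { toSubmodule := ⨅ I ∈ S, I.toSubmodule
      mul_mem_left' := fun a b hb => by
        simp only [AddSubsemigroup.mem_carrier, AddSubmonoid.mem_toSubsemigroup,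
          Submodule.mem_toAddSubmonoid, Submodule.mem_iInf] at hb ⊢
        exact fun I hI => I.mul_mem_left' a (hb I hI)
      mul_mem_right' := fun {b} a hb => by
        simp only [AddSubsemigroup.mem_carrier, AddSubmonoid.mem_toSubsemigroup,
          Submodule.mem_toAddSubmonoid, Submodule.mem_iInf] at hb ⊢
        exact fun I hI => I.mul_mem_right' a (hb I hI)
      isClosed' := by
        have : IsClosed (((⨅ I ∈ S, I.toSubmodule : Submodule ℂ A)) : Set A) := by
          simp only [Submodule.coe_iInf]
          exact isClosed_iInter fun I => isClosed_iInter fun _ => I.isClosed'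
        exact this }

theorem mem_sInf {S : Set (ClosedIdeal A)} {a : A} : a ∈ sInf S ↔ ∀ I ∈ S, a ∈ I := by
  change a ∈ (⨅ I ∈ S, I.toSubmodule : Submodule ℂ A) ↔ _
  simp only [Submodule.mem_iInf]
  rfl

/-- The lattice of ideals: infima are intersections, suprema are closed ideals generated by
unions. -/
instance : CompleteLattice (ClosedIdeal A) :=
  completeLatticeOfInf (ClosedIdeal A) fun _ =>
    ⟨fun I hI _ ha => mem_sInf.1 ha I hI, fun _ hJ _ ha => mem_sInf.2 fun _ hI => hJ hI ha⟩

/-- The annihilator `I^⊥ = {a | a b = 0 for all b ∈ I}`. -/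
def annihilator (I : ClosedIdeal A) : ClosedIdeal A where
  carrier := {a | ∀ b ∈ I, a * b = 0}
  add_mem' ha hb c hc := by rw [add_mul, ha c hc, hb c hc, add_zero]
  zero_mem' c _ := zero_mul c
  smul_mem' z a ha c hc := by rw [smul_mul_assoc, ha c hc, smul_zero]
  mul_mem_left' a b hb c hc := by
    rw [mul_assoc, hb c hc, mul_zero]
  mul_mem_right' a hb c hc := by
    rw [mul_assoc]
    exact hb _ (I.mul_mem_left' a hc)
  isClosed' := by
    have : {a : A | ∀ b ∈ I, a * b = 0} = ⋂ b ∈ I, {a : A | a * b = 0} := by ext; simp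
    change IsClosed {a : A | ∀ b ∈ I, a * b = 0}
    rw [this]
    exact isClosed_biInter fun b _ => isClosed_eq (by fun_prop) continuous_const

end ClosedIdeal

/-- A *-homomorphism `φ : A → M(B)` is a morphism from `A` to `B` if the span of
`φ(A) B` is dense in `B`. Here `(φ a).fst b` is the product `φ(a) b ∈ B`. -/
def IsMorphism (φ : A →⋆ₙₐ[ℂ] 𝓜(ℂ, B)) : Prop :=
  Dense (Submodule.span ℂ {c : B | ∃ (a : A) (b : B), (φ a).fst b = c} : Set B)

theorem morphism_continuous (φ : A →⋆ₙₐ[ℂ] 𝓜(ℂ, B)) : Continuous φ :=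
  AddMonoidHomClass.continuous_of_bound φ 1 fun a => by
    rw [one_mul]
    exact NonUnitalStarAlgHom.norm_apply_le φ a

theorem mul_fst_coe (m : 𝓜(ℂ, B)) (b : B) : m * (b : 𝓜(ℂ, B)) = (m.fst b : 𝓜(ℂ, B)) := by
  have key : ∀ x y : B, m.fst (x * y) = m.fst x * y := fun x y => by
    have h : ∀ z : B, z * (m.fst (x * y) - m.fst x * y) = 0 := fun z => by
      rw [mul_sub, ← m.central, ← mul_assoc z, ← m.central, mul_assoc, sub_self]
    exact sub_eq_zero.1 (CStarRing.star_mul_self_eq_zero_iff _ |>.1 (h _))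
  refine DoubleCentralizer.ext _ _ _ _ (Prod.ext ?_ ?_)
  · ext x
    exact key b x
  · ext x
    exact m.central x b

theorem coe_mul_snd (m : 𝓜(ℂ, B)) (b : B) : (b : 𝓜(ℂ, B)) * m = (m.snd b : 𝓜(ℂ, B)) := by
  have key : ∀ x y : B, m.snd (x * y) = x * m.snd y := fun x y => by
    have h : ∀ z : B, (m.snd (x * y) - x * m.snd y) * z = 0 := fun z => by
      rw [sub_mul, m.central, mul_assoc x (m.snd y), m.central, mul_assoc, sub_self]
    exact sub_eq_zero.1 (CStarRing.mul_star_self_eq_zero_iff _ |>.1 (h _))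
  refine DoubleCentralizer.ext _ _ _ _ (Prod.ext ?_ ?_)
  · ext x
    exact (m.central b x).symm
  · ext x
    exact key x b

/-- The Pimsner ideal `pim(φ) = φ⁻¹(B)` of `φ : A → M(B)`. -/
def pim (φ : A →⋆ₙₐ[ℂ] 𝓜(ℂ, B)) : ClosedIdeal A where
  carrier := {a | ∃ b : B, φ a = (b : 𝓜(ℂ, B))}
  add_mem' := by
    rintro a a' ⟨b, hb⟩ ⟨b', hb'⟩
    exact ⟨b + b', by
      rw [map_add, hb, hb']
      exact (map_add (DoubleCentralizer.coeHom (𝕜 := ℂ) (A := B)) b b').symm⟩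
  zero_mem' := ⟨0, by
    rw [map_zero]
    exact (map_zero (DoubleCentralizer.coeHom (𝕜 := ℂ) (A := B))).symm⟩
  smul_mem' := by
    rintro z a ⟨b, hb⟩
    exact ⟨z • b, by
      rw [map_smul, hb]
      exact (map_smul (DoubleCentralizer.coeHom (𝕜 := ℂ) (A := B)) z b).symm⟩
  mul_mem_left' := by
    rintro a a' ⟨b, hb⟩
    exact ⟨(φ a).fst b, by rw [map_mul, hb, mul_fst_coe]⟩
  mul_mem_right' := by
    rintro a a' ⟨b, hb⟩
    exact ⟨(φ a').snd b, by rw [map_mul, hb, coe_mul_snd]⟩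
  isClosed' := by
    have hiso : Isometry (DoubleCentralizer.coeHom (𝕜 := ℂ) (A := B)) :=
      NonUnitalStarAlgHom.isometry _ fun b b' h => by
        have h1 : ∀ z : B, (b - b') * z = 0 := fun z => by
          have := congrArg (fun m : 𝓜(ℂ, B) => m.fst z) h
          rw [sub_mul]
          exact sub_eq_zero.2 this
        exact sub_eq_zero.1 (CStarRing.mul_star_self_eq_zero_iff _ |>.1 (h1 _))
    have h2 : IsClosed (Set.range (DoubleCentralizer.coeHom (𝕜 := ℂ) (A := B))) :=
      hiso.isClosedEmbedding.isClosed_range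
    have h3 : {a | ∃ b : B, φ a = (b : 𝓜(ℂ, B))} =
        φ ⁻¹' Set.range (DoubleCentralizer.coeHom (𝕜 := ℂ) (A := B)) := by
      ext a
      exact ⟨fun ⟨b, hb⟩ => ⟨b, hb.symm⟩, fun ⟨b, hb⟩ => ⟨b, hb.symm⟩⟩
    change IsClosed {a | ∃ b : B, φ a = (b : 𝓜(ℂ, B))}
    rw [h3]
    exact h2.preimage (morphism_continuous φ)

/-- The kernel of `φ : A → M(B)`. -/
def ker (φ : A →⋆ₙₐ[ℂ] 𝓜(ℂ, B)) : ClosedIdeal A where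
  carrier := {a | φ a = 0}
  add_mem' ha hb := by
    change φ _ = 0
    rw [map_add, show φ _ = 0 from ha, show φ _ = 0 from hb, add_zero]
  zero_mem' := map_zero φ
  smul_mem' z a ha := by
    change φ _ = 0
    rw [map_smul, show φ _ = 0 from ha, smul_zero]
  mul_mem_left' a b hb := by
    change φ (a * b) = 0
    rw [map_mul, show φ b = 0 from hb, mul_zero]
  mul_mem_right' {b} a hb := by
    change φ (b * a) = 0
    rw [map_mul, show φ b = 0 from hb, zero_mul]
  isClosed' := isClosed_eq (morphism_continuous φ) continuous_const

/-- The Katsura ideal `kat(φ) = pim(φ) ∩ ker(φ)^⊥`. -/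
def kat (φ : A →⋆ₙₐ[ℂ] 𝓜(ℂ, B)) : ClosedIdeal A := pim φ ⊓ (ker φ).annihilator

/-- `J` is `φ`-proper if `φ(J) ⊆ B`. -/
def IsProperFor (φ : A →⋆ₙₐ[ℂ] 𝓜(ℂ, B)) (J : ClosedIdeal A) : Prop :=
  ∀ a ∈ J, ∃ b : B, φ a = (b : 𝓜(ℂ, B))

/-- `J` is `φ`-perfect if it is `φ`-proper and `φ` is injective on `J`. -/
def IsPerfectFor (φ : A →⋆ₙₐ[ℂ] 𝓜(ℂ, B)) (J : ClosedIdeal A) : Prop :=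
  IsProperFor φ J ∧ Set.InjOn φ J

end Ideals

/-! ### Hilbert modules

A right Hilbert `A`-module is a complex Banach space `X` with `[SMul Aᵐᵒᵖ X] [CStarModule Aᵐᵒᵖ X]`,
where `x · a = op a • x`. Mathlib's axiom for `CStarModule Aᵐᵒᵖ X` reads
`inner x (op a • y) = op a * inner x y`, which in terms of the `A`-valued inner product
`⟨x | y⟩_A = unop (inner x y)` says `⟨x | y · a⟩_A = ⟨x | y⟩_A a`. -/

section PreHilbert

open CStarModule

variable {C E : Type*} [NonUnitalCStarAlgebra C] [PartialOrder C] [StarOrderedRing C]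
  [NormedAddCommGroup E] [NormedSpace ℂ E] [SMul C E] [CStarModule C E]

theorem ext_inner {x y : E} (h : ∀ w : E, inner C w x = inner C w y) : x = y := by
  rw [← sub_eq_zero, ← CStarModule.inner_self (A := C), CStarModule.inner_sub_right, h, sub_self]

theorem op_smul_add (c : C) (x y : E) : c • (x + y) = c • x + c • y :=
  ext_inner (C := C) fun w => by simp [mul_add]

theorem add_op_smul (c d : C) (x : E) : (c + d) • x = c • x + d • x :=
  ext_inner (C := C) fun w => by simp [add_mul]

theorem op_smul_smul (c : C) (z : ℂ) (x : E) : c • z • x = z • c • x :=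
  ext_inner (C := C) fun w => by simp [mul_smul_comm]

theorem smul_op_smul (c : C) (z : ℂ) (x : E) : (z • c) • x = z • c • x :=
  ext_inner (C := C) fun w => by simp [smul_mul_assoc]

theorem mul_op_smul (c d : C) (x : E) : (c * d) • x = c • d • x :=
  ext_inner (C := C) fun w => by simp [mul_assoc]

theorem norm_op_smul_le (c : C) (x : E) : ‖c • x‖ ≤ ‖c‖ * ‖x‖ := by
  have h : ‖c • x‖ ^ 2 ≤ (‖c‖ * ‖x‖) ^ 2 := by
    rw [norm_sq_eq C, inner_op_smul_right, inner_op_smul_left]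
    calc ‖c * (inner C x x * star c)‖ ≤ ‖c‖ * (‖inner C x x‖ * ‖star c‖) :=
          (norm_mul_le _ _).trans (by gcongr; exact norm_mul_le _ _)
      _ = (‖c‖ * ‖x‖) ^ 2 := by rw [← norm_sq_eq C, norm_star]; ring
  exact le_of_sq_le_sq h (by positivity)

/-- The action of `c` as a bounded linear operator. -/
def opSMulL (c : C) : E →L[ℂ] E :=
  LinearMap.mkContinuous
    { toFun := fun x => c • x
      map_add' := op_smul_add c
      map_smul' := fun z x => op_smul_smul c z x } ‖c‖ (norm_op_smul_le c)

variable (C) in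
/-- The rank-one operator `z ↦ x · ⟨y | z⟩`. -/
def rankOneL (x y : E) : E →L[ℂ] E :=
  LinearMap.mkContinuous
    { toFun := fun z => inner C y z • x
      map_add' := fun z w => by rw [CStarModule.inner_add_right, add_op_smul]
      map_smul' := fun c z => by
        rw [inner_smul_right_complex, smul_op_smul, RingHom.id_apply] } (‖y‖ * ‖x‖) fun z => by
    calc ‖inner C y z • x‖ ≤ ‖inner C y z‖ * ‖x‖ := norm_op_smul_le _ _
      _ ≤ (‖y‖ * ‖z‖) * ‖x‖ := by gcongr; exact norm_inner_le E
      _ = ‖y‖ * ‖x‖ * ‖z‖ := by ring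

theorem uniformContinuousConstSMul : UniformContinuousConstSMul C E where
  uniformContinuous_const_smul c := (opSMulL (E := E) c).uniformContinuous

theorem completion_coe_op_smul (c : C) (a : E) :
    ((c • a : E) : UniformSpace.Completion E) = c • (a : UniformSpace.Completion E) :=
  haveI : UniformContinuousConstSMul C E := uniformContinuousConstSMul
  UniformSpace.Completion.coe_smul c a

theorem completion_continuous_op_smul (c : C) :
    Continuous fun x : UniformSpace.Completion E => c • x :=
  UniformSpace.Completion.continuous_map

theorem completion_inner_coe (a b : E) :
    inner C (a : UniformSpace.Completion E) (b : UniformSpace.Completion E) = inner C a b :=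
  (UniformSpace.Completion.isDenseInducing_coe.prodMap
    UniformSpace.Completion.isDenseInducing_coe).extend_eq
    (continuous_inner : Continuous (Function.uncurry (inner C : E → E → C))) (a, b)

theorem completion_continuous_inner :
    Continuous (Function.uncurry (inner C (E := UniformSpace.Completion E))) := by
  let inner' : E →+ E →+ C :=
    { toFun := fun x => (innerₛₗ (A := C) x : E →ₗ[ℂ] C).toAddMonoidHom
      map_zero' := by ext x; exact inner_zero_left
      map_add' := fun x y => by ext z; exact CStarModule.inner_add_left }
  have : Continuous fun p : E × E => inner' p.1 p.2 := continuous_inner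
  change Continuous
      (((UniformSpace.Completion.isDenseInducing_toCompl E).prodMap
        (UniformSpace.Completion.isDenseInducing_toCompl E)).extend fun p : E × E =>
          inner' p.1 p.2)
  exact (UniformSpace.Completion.isDenseInducing_toCompl E).extend_Z_bilin
    (UniformSpace.Completion.isDenseInducing_toCompl E) this

theorem completion_continuous_inner' {α : Type*} [TopologicalSpace α]
    {f g : α → UniformSpace.Completion E} (hf : Continuous f) (hg : Continuous g) :
    Continuous fun x => inner C (f x) (g x) :=
  completion_continuous_inner.comp (hf.prodMk hg)

/-- The completion of a pre-Hilbert module, with the inner product and the action extended by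
continuity. -/
instance : CStarModule C (UniformSpace.Completion E) where
  inner_add_right {x y z} :=
    UniformSpace.Completion.induction_on₃ x y z
      (isClosed_eq (completion_continuous_inner' (by fun_prop) (by fun_prop))
        ((completion_continuous_inner' (by fun_prop) (by fun_prop)).add
          (completion_continuous_inner' (by fun_prop) (by fun_prop))))
      fun a b c => by
        rw [← UniformSpace.Completion.coe_add]
        simp only [completion_inner_coe, CStarModule.inner_add_right]
  inner_self_nonneg {x} :=
    UniformSpace.Completion.induction_on x
      (isClosed_le continuous_const (completion_continuous_inner' continuous_id continuous_id))
      fun a => by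
        rw [completion_inner_coe]
        exact inner_self_nonneg
  inner_self {x} := by
    have h : ‖x‖ ^ 2 = ‖inner C x x‖ :=
      UniformSpace.Completion.induction_on x
        (isClosed_eq (by fun_prop)
          (completion_continuous_inner' continuous_id continuous_id).norm)
        fun a => by rw [completion_inner_coe, UniformSpace.Completion.norm_coe, norm_sq_eq C]
    rw [← norm_eq_zero (a := inner C x x), ← h, sq_eq_zero_iff, norm_eq_zero]
  inner_op_smul_right {c x y} :=
    UniformSpace.Completion.induction_on₂ x y
      (isClosed_eq
        (completion_continuous_inner' continuous_fst
          ((completion_continuous_op_smul c).comp continuous_snd))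
        ((continuous_const_mul c).comp
          (completion_continuous_inner' continuous_fst continuous_snd)))
      fun a b => by
        rw [← completion_coe_op_smul]
        simp only [completion_inner_coe, inner_op_smul_right]
  inner_smul_right_complex {c x y} :=
    UniformSpace.Completion.induction_on₂ x y
      (isClosed_eq
        (completion_continuous_inner' continuous_fst
          ((continuous_const_smul c).comp continuous_snd))
        ((completion_continuous_inner' continuous_fst continuous_snd).const_smul c))
      fun a b => by
        rw [← UniformSpace.Completion.coe_smul c b]
        simp only [completion_inner_coe, CStarModule.inner_smul_right_complex]
  star_inner x y :=
    UniformSpace.Completion.induction_on₂ x y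
      (isClosed_eq (completion_continuous_inner' (by fun_prop) (by fun_prop)).star
        (completion_continuous_inner' (by fun_prop) (by fun_prop)))
      fun a b => by simp only [completion_inner_coe, CStarModule.star_inner]
  norm_eq_sqrt_norm_inner_self x :=
    UniformSpace.Completion.induction_on x
      (isClosed_eq (by fun_prop)
        (completion_continuous_inner' continuous_id continuous_id).norm.sqrt)
      fun a => by
        rw [completion_inner_coe, UniformSpace.Completion.norm_coe,
          norm_eq_sqrt_norm_inner_self (A := C)]

end PreHilbert

/-! ### Adjointable and compact operators -/

section Operators

variable (A X : Type*) [NonUnitalCStarAlgebra A] [PartialOrder A] [StarOrderedRing A]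
  [NormedAddCommGroup X] [NormedSpace ℂ X] [SMul Aᵐᵒᵖ X] [CStarModule Aᵐᵒᵖ X]

variable {X} in
/-- The `A`-valued inner product `⟨x | y⟩_A`, conjugate-linear in `x`, `A`-linear in `y`. -/
def rinner (x y : X) : A := unop (inner Aᵐᵒᵖ x y)

/-- `X` is full if the inner products span a dense subspace of `A`. -/
def IsFull : Prop :=
  Dense (Submodule.span ℂ {a : A | ∃ x y : X, rinner A x y = a} : Set A)

/-- The adjointable operators on `X`, as a subalgebra of the bounded operators. (Adjointable maps are automatically bounded and
`A`-linear.) -/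
def adjointable : Subalgebra ℂ (X →L[ℂ] X) where
  carrier := {T | ∃ S : X →L[ℂ] X, ∀ x y, rinner A (T x) y = rinner A x (S y)}
  mul_mem' := by
    rintro T T' ⟨S, hS⟩ ⟨S', hS'⟩
    exact ⟨S' * S, fun x y => by
      change rinner A (T (T' x)) y = rinner A x (S' (S y))
      rw [hS, hS']⟩
  add_mem' := by
    rintro T T' ⟨S, hS⟩ ⟨S', hS'⟩
    refine ⟨S + S', fun x y => ?_⟩
    have h1 := hS x y
    have h2 := hS' x y
    simp only [rinner, unop_inj] at h1 h2 ⊢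
    simp [h1, h2]
  algebraMap_mem' z := ⟨algebraMap ℂ _ (star z), fun x y => by
    simp [rinner, Algebra.algebraMap_eq_smul_one]⟩

variable {A X}

instance : NormedRing (adjointable A X) := inferInstance
instance : NormedAlgebra ℂ (adjointable A X) := inferInstance
instance : Module ℂ (adjointable A X) := inferInstance
instance : SMul ℂ (adjointable A X) := inferInstance
instance : AddCommGroup (adjointable A X) := inferInstance
instance : AddCommMonoid (adjointable A X) := inferInstance
instance : Mul (adjointable A X) := inferInstance
instance : TopologicalSpace (adjointable A X) := inferInstance
instance : IsTopologicalRing (adjointable A X) := inferInstance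
instance : ContinuousSMul ℂ (adjointable A X) := inferInstance
instance : ContinuousConstSMul ℂ (adjointable A X) := inferInstance

theorem rinner_eq_iff {x y x' y' : X} :
    rinner A x y = rinner A x' y' ↔ inner Aᵐᵒᵖ x y = inner Aᵐᵒᵖ x' y' := unop_inj

instance : Star (adjointable A X) where
  star T := ⟨T.2.choose, T.1, fun x y => by
    have h := congrArg star (rinner_eq_iff.1 (T.2.choose_spec y x)).symm
    rw [CStarModule.star_inner, CStarModule.star_inner] at h
    exact rinner_eq_iff.2 h⟩

theorem adj_inner_star_right (T : adjointable A X) (x y : X) :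
    inner Aᵐᵒᵖ x ((star T).1 y) = inner Aᵐᵒᵖ (T.1 x) y :=
  (rinner_eq_iff.1 (T.2.choose_spec x y)).symm

theorem adj_inner_star_left (T : adjointable A X) (x y : X) :
    inner Aᵐᵒᵖ ((star T).1 x) y = inner Aᵐᵒᵖ x (T.1 y) := by
  rw [← CStarModule.star_inner, adj_inner_star_right, CStarModule.star_inner]

theorem adjointable_ext {S T : adjointable A X}
    (h : ∀ x y : X, inner Aᵐᵒᵖ x (S.1 y) = inner Aᵐᵒᵖ x (T.1 y)) : S = T :=
  Subtype.ext (ContinuousLinearMap.ext fun y => ext_inner (C := Aᵐᵒᵖ) fun x => h x y)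

theorem adjointable_op_smul (T : adjointable A X) (a : Aᵐᵒᵖ) (x : X) :
    T.1 (a • x) = a • T.1 x :=
  ext_inner (C := Aᵐᵒᵖ) fun w => by
    rw [← adj_inner_star_left, CStarModule.inner_op_smul_right, CStarModule.inner_op_smul_right,
      adj_inner_star_left]

instance : StarRing (adjointable A X) where
  star_involutive T := adjointable_ext fun x y => by rw [adj_inner_star_right, adj_inner_star_left]
  star_mul S T := adjointable_ext fun x y => by
    rw [adj_inner_star_right]
    change inner Aᵐᵒᵖ (S.1 (T.1 x)) y = inner Aᵐᵒᵖ x ((star T).1 ((star S).1 y))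
    rw [adj_inner_star_right, adj_inner_star_right]
  star_add S T := adjointable_ext fun x y => by
    rw [adj_inner_star_right]
    change inner Aᵐᵒᵖ (S.1 x + T.1 x) y = inner Aᵐᵒᵖ x ((star S).1 y + (star T).1 y)
    rw [CStarModule.inner_add_left, CStarModule.inner_add_right, adj_inner_star_right,
      adj_inner_star_right]

instance : StarModule ℂ (adjointable A X) where
  star_smul z T := adjointable_ext fun x y => by
    rw [adj_inner_star_right]
    change inner Aᵐᵒᵖ (z • T.1 x) y = inner Aᵐᵒᵖ x (star z • (star T).1 y)
    rw [CStarModule.inner_smul_left_complex, CStarModule.inner_smul_right_complex,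
      adj_inner_star_right]

instance : CStarRing (adjointable A X) where
  norm_mul_self_le T := by
    have h : ‖T‖ ≤ √‖star T * T‖ := by
      refine ContinuousLinearMap.opNorm_le_bound _ (Real.sqrt_nonneg _) fun x => ?_
      change ‖T.1 x‖ ≤ _
      refine le_of_sq_le_sq ?_ (by positivity)
      rw [mul_pow, Real.sq_sqrt (norm_nonneg (star T * T)),
        CStarModule.norm_sq_eq Aᵐᵒᵖ (x := T.1 x), ← adj_inner_star_right]
      calc ‖inner Aᵐᵒᵖ x ((star T).1 (T.1 x))‖ ≤ ‖x‖ * ‖(star T * T).1 x‖ :=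
            CStarModule.norm_inner_le X
        _ ≤ ‖x‖ * (‖star T * T‖ * ‖x‖) := by
            gcongr
            exact (star T * T).1.le_opNorm x
        _ = _ := by ring
    calc ‖T‖ * ‖T‖ ≤ √‖star T * T‖ * √‖star T * T‖ := by gcongr
      _ = ‖star T * T‖ := Real.mul_self_sqrt (norm_nonneg _)

instance : NormedStarGroup (adjointable A X) := inferInstance
instance : ContinuousStar (adjointable A X) := inferInstance

instance [CompleteSpace X] : CompleteSpace (adjointable A X) := by
  refine Metric.complete_of_cauchySeq_tendsto fun u hu => ?_
  have hu1 : CauchySeq fun n => (u n).1 := hu.map uniformContinuous_subtype_val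
  have hu2 : CauchySeq fun n => (star (u n)).1 :=
    (hu.map (starₗᵢ ℂ (E := adjointable A X)).isometry.uniformContinuous).map
      uniformContinuous_subtype_val
  obtain ⟨T, hT⟩ := cauchySeq_tendsto_of_complete hu1
  obtain ⟨S, hS⟩ := cauchySeq_tendsto_of_complete hu2
  have hTS : ∀ x y, rinner A (T x) y = rinner A x (S y) := fun x y => by
    have h1 : Filter.Tendsto (fun n => (u n).1 x) Filter.atTop (nhds (T x)) :=
      ((ContinuousLinearMap.apply ℂ X x).continuous.tendsto T).comp hT
    have h2 : Filter.Tendsto (fun n => (star (u n)).1 y) Filter.atTop (nhds (S y)) :=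
      ((ContinuousLinearMap.apply ℂ X y).continuous.tendsto S).comp hS
    have h3 : Filter.Tendsto (fun n => inner Aᵐᵒᵖ ((u n).1 x) y) Filter.atTop
        (nhds (inner Aᵐᵒᵖ (T x) y)) :=
      (CStarModule.continuous_inner.tendsto (T x, y)).comp (h1.prodMk_nhds tendsto_const_nhds)
    have h4 : Filter.Tendsto (fun n => inner Aᵐᵒᵖ x ((star (u n)).1 y)) Filter.atTop
        (nhds (inner Aᵐᵒᵖ x (S y))) :=
      (CStarModule.continuous_inner.tendsto (x, S y)).comp (tendsto_const_nhds.prodMk_nhds h2)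
    rw [rinner_eq_iff]
    refine tendsto_nhds_unique h3 (h4.congr fun n => ?_)
    rw [adj_inner_star_right]
  exact ⟨⟨T, S, hTS⟩, tendsto_subtype_rng.2 hT⟩

instance [CompleteSpace X] : CStarAlgebra (adjointable A X) where

variable [CompleteSpace X]

variable (A X) in
/-- The C*-algebra `L_A(X)` of adjointable operators, with the operator norm. -/
def LOp : Type _ := adjointable A X

instance : CStarAlgebra (LOp A X) := inferInstanceAs (CStarAlgebra (adjointable A X))

namespace LOp

/-- The underlying bounded operator. -/
def toCLM (T : LOp A X) : X →L[ℂ] X := T.1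

instance : FunLike (LOp A X) X X where
  coe T := T.1
  coe_injective _ _ h := Subtype.ext (DFunLike.coe_injective h)

instance : ContinuousLinearMapClass (LOp A X) ℂ X X where
  map_add T := T.1.map_add
  map_smulₛₗ T := T.1.map_smul
  map_continuous T := T.1.continuous

@[simp] theorem zero_apply (x : X) : (0 : LOp A X) x = 0 := rfl
@[simp] theorem one_apply (x : X) : (1 : LOp A X) x = x := rfl
@[simp] theorem add_apply (S T : LOp A X) (x : X) : (S + T) x = S x + T x := rfl
@[simp] theorem smul_apply (z : ℂ) (T : LOp A X) (x : X) : (z • T) x = z • T x := rfl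
@[simp] theorem mul_apply (S T : LOp A X) (x : X) : (S * T) x = S (T x) := rfl

theorem sum_apply {ι : Type*} (s : Finset ι) (T : ι → LOp A X) (x : X) :
    (∑ i ∈ s, T i) x = ∑ i ∈ s, T i x :=
  map_sum ({ toFun := fun T => T x, map_zero' := rfl, map_add' := fun _ _ => rfl } :
    LOp A X →+ X) T s

theorem norm_def (T : LOp A X) : ‖T‖ = ‖(T.1 : X →L[ℂ] X)‖ := rfl

@[ext] theorem ext {S T : LOp A X} (h : ∀ x, S x = T x) : S = T := DFunLike.ext _ _ h

theorem inner_star_right (T : LOp A X) (x y : X) :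
    inner Aᵐᵒᵖ x ((star T) y) = inner Aᵐᵒᵖ (T x) y := adj_inner_star_right T x y

theorem inner_star_left (T : LOp A X) (x y : X) :
    inner Aᵐᵒᵖ ((star T) x) y = inner Aᵐᵒᵖ x (T y) := adj_inner_star_left T x y

theorem ext_inner {S T : LOp A X}
    (h : ∀ x y : X, inner Aᵐᵒᵖ x (S y) = inner Aᵐᵒᵖ x (T y)) : S = T := adjointable_ext h

theorem eq_star {S T : LOp A X} (h : ∀ x y : X, inner Aᵐᵒᵖ (T x) y = inner Aᵐᵒᵖ x (S y)) :
    S = star T :=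
  ext_inner fun x y => by rw [inner_star_right, h]

theorem map_op_smul (T : LOp A X) (a : Aᵐᵒᵖ) (x : X) : T (a • x) = a • T x :=
  adjointable_op_smul T a x

end LOp

variable (A) in
/-- The operator `Θ_{x,y} : z ↦ x · ⟨y | z⟩_A`. -/
def theta (x y : X) : LOp A X :=
  ⟨rankOneL Aᵐᵒᵖ x y, rankOneL Aᵐᵒᵖ y x, fun z w => by
    rw [rinner_eq_iff]
    change inner Aᵐᵒᵖ (inner Aᵐᵒᵖ y z • x) w = inner Aᵐᵒᵖ z (inner Aᵐᵒᵖ x w • y)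
    simp⟩

theorem theta_apply (x y z : X) : theta A x y z = op (rinner A y z) • x := rfl

theorem star_theta (x y : X) : star (theta A x y) = theta A y x :=
  LOp.ext_inner fun z w => by
    rw [LOp.inner_star_right]
    change inner Aᵐᵒᵖ (inner Aᵐᵒᵖ y z • x) w = inner Aᵐᵒᵖ z (inner Aᵐᵒᵖ x w • y)
    simp

theorem mul_theta (T : LOp A X) (x y : X) : T * theta A x y = theta A (T x) y :=
  LOp.ext fun _ => LOp.map_op_smul T _ x

theorem theta_mul (T : LOp A X) (x y : X) : theta A x y * T = theta A x (star T y) := by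
  rw [← star_star (theta A x y * T), star_mul, star_theta, mul_theta, star_theta]

variable (A) in
/-- The closed linear span in `L_A(X)` of the operators `Θ_{x,y}` with `x, y ∈ S`. -/
def thetaSpan (S : Set X) : Submodule ℂ (LOp A X) :=
  (Submodule.span ℂ {T | ∃ x ∈ S, ∃ y ∈ S, theta A x y = T}).topologicalClosure

theorem thetaSpan_induction {S : Set X} {p : LOp A X → Prop}
    (hp : IsClosed {T | p T}) (h0 : p 0) (hadd : ∀ T T', p T → p T' → p (T + T'))
    (hsmul : ∀ (z : ℂ) T, p T → p (z • T)) (hθ : ∀ x ∈ S, ∀ y ∈ S, p (theta A x y))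
    {T : LOp A X} (hT : T ∈ thetaSpan A S) : p T := by
  refine closure_minimal (fun T hT => ?_) hp (show T ∈ closure _ from hT)
  refine Submodule.span_induction ?_ h0 (fun T T' _ _ => hadd T T') (fun z T _ => hsmul z T) hT
  rintro _ ⟨x, hx, y, hy, rfl⟩
  exact hθ x hx y hy

theorem theta_mem {S : Set X} {x y : X} (hx : x ∈ S) (hy : y ∈ S) :
    theta A x y ∈ thetaSpan A S :=
  Submodule.le_topologicalClosure _ (Submodule.subset_span ⟨x, hx, y, hy, rfl⟩)

theorem isClosed_thetaSpan (S : Set X) : IsClosed (thetaSpan A S : Set (LOp A X)) :=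
  Submodule.isClosed_topologicalClosure _

theorem mul_mem_thetaSpan {S : Set X} (hS : ∀ (T : LOp A X), ∀ x ∈ S, T x ∈ S)
    (T : LOp A X) {K : LOp A X} (hK : K ∈ thetaSpan A S) :
    T * K ∈ thetaSpan A S := by
  refine thetaSpan_induction (p := fun K => T * K ∈ thetaSpan A S)
    ((isClosed_thetaSpan S).preimage (continuous_const_mul T)) ?_ ?_ ?_ ?_ hK
  · rw [mul_zero]; exact zero_mem _
  · intro K K' h h'; rw [mul_add]; exact add_mem h h'
  · intro z K h; rw [mul_smul_comm]; exact Submodule.smul_mem _ z h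
  · intro x hx y hy; rw [mul_theta]; exact theta_mem (hS T x hx) hy

theorem mem_mul_thetaSpan {S : Set X} (hS : ∀ (T : LOp A X), ∀ x ∈ S, T x ∈ S)
    (T : LOp A X) {K : LOp A X} (hK : K ∈ thetaSpan A S) :
    K * T ∈ thetaSpan A S := by
  refine thetaSpan_induction (p := fun K => K * T ∈ thetaSpan A S)
    ((isClosed_thetaSpan S).preimage (continuous_mul_const T)) ?_ ?_ ?_ ?_ hK
  · rw [zero_mul]; exact zero_mem _
  · intro K K' h h'; rw [add_mul]; exact add_mem h h'
  · intro z K h; rw [smul_mul_assoc]; exact Submodule.smul_mem _ z h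
  · intro x hx y hy; rw [theta_mul]; exact theta_mem hx (hS (star T) y hy)

variable (A X) in
/-- The algebra `K_A(X)` of compact operators: the closed linear span of all `Θ_{x,y}`. -/
def compacts : NonUnitalStarSubalgebra ℂ (LOp A X) where
  toSubmodule := thetaSpan A Set.univ
  mul_mem' {T K} _ hK := mul_mem_thetaSpan (S := Set.univ) (fun _ _ _ => Set.mem_univ _) T hK
  star_mem' {K} hK := by
    refine thetaSpan_induction (S := Set.univ) (p := fun K => star K ∈ thetaSpan A Set.univ)
      ((isClosed_thetaSpan _).preimage continuous_star) ?_ ?_ ?_ ?_ hK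
    · rw [star_zero]; exact zero_mem _
    · intro K K' h h'; rw [star_add]; exact add_mem h h'
    · intro z K h; rw [star_smul]; exact Submodule.smul_mem _ _ h
    · intro x hx y hy; rw [star_theta]; exact theta_mem hy hx

instance : IsClosed (compacts A X : Set (LOp A X)) := isClosed_thetaSpan _

theorem mul_mem_compacts (T : LOp A X) {K : LOp A X} (hK : K ∈ compacts A X) :
    T * K ∈ compacts A X :=
  mul_mem_thetaSpan (S := Set.univ) (fun _ _ _ => Set.mem_univ _) T hK

theorem mem_mul_compacts (T : LOp A X) {K : LOp A X} (hK : K ∈ compacts A X) :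
    K * T ∈ compacts A X :=
  mem_mul_thetaSpan (S := Set.univ) (fun _ _ _ => Set.mem_univ _) T hK

variable (A X) in
/-- The C*-algebra `K_A(X)` of compact operators. -/
def KOp : Type _ := compacts A X

instance : NonUnitalCStarAlgebra (KOp A X) := inferInstanceAs (NonUnitalCStarAlgebra (compacts A X))

/-- The inclusion `K_A(X) → L_A(X)`. -/
def KOp.incl : KOp A X →⋆ₙₐ[ℂ] LOp A X where
  toFun K := K.1
  map_smul' _ _ := rfl
  map_zero' := rfl
  map_add' _ _ := rfl
  map_mul' _ _ := rfl
  map_star' _ := rfl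

theorem KOp.ext {K K' : KOp A X} (h : KOp.incl K = KOp.incl K') : K = K' := Subtype.ext h

theorem KOp.continuous_incl : Continuous (KOp.incl (A := A) (X := X)) := continuous_subtype_val

theorem KOp.norm_incl (K : KOp A X) : ‖KOp.incl K‖ = ‖K‖ := rfl

theorem KOp.incl_mem (K : KOp A X) : KOp.incl K ∈ compacts A X := K.2

variable (X) in
/-- The set `X · I = {x · a | x ∈ X, a ∈ I}`. -/
def smulIdeal (I : ClosedIdeal A) : Set X := {z | ∃ (x : X), ∃ a ∈ I, op a • x = z}

theorem map_mem_smulIdeal (I : ClosedIdeal A) (T : LOp A X) :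
    ∀ x ∈ smulIdeal X I, T x ∈ smulIdeal X I := by
  rintro _ ⟨x, a, ha, rfl⟩
  exact ⟨T x, a, ha, (LOp.map_op_smul T _ x).symm⟩

variable (X) in
/-- `K_A(X · I)` as an ideal of `K_A(X)`: the closed linear span of the operators `Θ_{x,y}` with
`x, y ∈ X · I`. -/
def compactsIdeal (I : ClosedIdeal A) : ClosedIdeal (KOp A X) where
  carrier := {K | KOp.incl K ∈ thetaSpan A (smulIdeal X I)}
  add_mem' {K K'} h h' := by
    change KOp.incl (K + K') ∈ thetaSpan A (smulIdeal X I)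
    rw [map_add]
    exact add_mem h h'
  zero_mem' := by
    change KOp.incl 0 ∈ thetaSpan A (smulIdeal X I)
    rw [map_zero]
    exact zero_mem _
  smul_mem' z K h := by
    change KOp.incl (z • K) ∈ thetaSpan A (smulIdeal X I)
    rw [map_smul]
    exact Submodule.smul_mem _ z h
  mul_mem_left' T K h := by
    change KOp.incl (T * K) ∈ thetaSpan A (smulIdeal X I)
    rw [map_mul]
    exact mul_mem_thetaSpan (map_mem_smulIdeal I) _ h
  mul_mem_right' {K} T h := by
    change KOp.incl (K * T) ∈ thetaSpan A (smulIdeal X I)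
    rw [map_mul]
    exact mem_mul_thetaSpan (map_mem_smulIdeal I) _ h
  isClosed' := (isClosed_thetaSpan (smulIdeal X I)).preimage KOp.continuous_incl

/-- The canonical *-homomorphism `L_A(X) → M(K_A(X))` (an isomorphism), sending `S` to left and
right multiplication by `S`. -/
def toMultiplier : LOp A X →⋆ₙₐ[ℂ] 𝓜(ℂ, KOp A X) where
  toFun S :=
    { fst := LinearMap.mkContinuous
        { toFun := fun K => ⟨S * (KOp.incl K), mul_mem_compacts S K.2⟩
          map_add' := fun K K' => KOp.ext (mul_add S (KOp.incl K) (KOp.incl K'))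
          map_smul' := fun z K => KOp.ext (mul_smul_comm z S (KOp.incl K)) } ‖S‖
        fun K => norm_mul_le S (KOp.incl K)
      snd := LinearMap.mkContinuous
        { toFun := fun K => ⟨(KOp.incl K) * S, mem_mul_compacts S K.2⟩
          map_add' := fun K K' => KOp.ext (add_mul (KOp.incl K) (KOp.incl K') S)
          map_smul' := fun z K => KOp.ext (smul_mul_assoc z (KOp.incl K) S) } ‖S‖
        fun K => (norm_mul_le (KOp.incl K) S).trans_eq (mul_comm _ _)
      central := fun K K' => KOp.ext (mul_assoc (KOp.incl K) S (KOp.incl K')) }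
  map_smul' z S := by
    refine DoubleCentralizer.ext _ _ _ _ (Prod.ext ?_ ?_) <;> ext1 K <;> apply KOp.ext
    · exact smul_mul_assoc z S (KOp.incl K)
    · exact mul_smul_comm z (KOp.incl K) S
  map_zero' := by
    refine DoubleCentralizer.ext _ _ _ _ (Prod.ext ?_ ?_) <;> ext1 K <;> apply KOp.ext
    · exact zero_mul (KOp.incl K)
    · exact mul_zero (KOp.incl K)
  map_add' S T := by
    refine DoubleCentralizer.ext _ _ _ _ (Prod.ext ?_ ?_) <;> ext1 K <;> apply KOp.ext
    · exact add_mul S T (KOp.incl K)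
    · exact mul_add (KOp.incl K) S T
  map_mul' S T := by
    refine DoubleCentralizer.ext _ _ _ _ (Prod.ext ?_ ?_) <;> ext1 K <;> apply KOp.ext
    · exact mul_assoc S T (KOp.incl K)
    · exact (mul_assoc (KOp.incl K) S T).symm
  map_star' S := by
    refine DoubleCentralizer.ext _ _ _ _ (Prod.ext ?_ ?_) <;> ext1 K <;> apply KOp.ext
    · change star S * (KOp.incl K) = star (star (KOp.incl K) * S)
      rw [star_mul, star_star]
    · change (KOp.incl K) * star S = star (S * star (KOp.incl K))
      rw [star_mul, star_star]

theorem toMultiplier_fst (S : LOp A X) (K : KOp A X) :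
    KOp.incl ((toMultiplier S).fst K) = S * (KOp.incl K) := rfl

theorem toMultiplier_snd (S : LOp A X) (K : KOp A X) :
    KOp.incl ((toMultiplier S).snd K) = (KOp.incl K) * S := rfl

end Operators

/-! ### The interior tensor product -/

section Tensor

variable {A B X Y : Type*}
  [NonUnitalCStarAlgebra A] [PartialOrder A] [StarOrderedRing A]
  [NonUnitalCStarAlgebra B] [PartialOrder B] [StarOrderedRing B]
  [NormedAddCommGroup X] [NormedSpace ℂ X] [SMul Aᵐᵒᵖ X] [CStarModule Aᵐᵒᵖ X] [CompleteSpace X]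
  [NormedAddCommGroup Y] [NormedSpace ℂ Y] [SMul Bᵐᵒᵖ Y] [CStarModule Bᵐᵒᵖ Y] [CompleteSpace Y]

theorem exists_negPart {M : Type*} [NonUnitalCStarAlgebra M] [PartialOrder M] [StarOrderedRing M]
    {G : M} (hG : IsSelfAdjoint G) : ∃ H R : M, star H = H ∧ H = star R * R ∧
      G * H = -(H * H) ∧ (H = 0 → ∃ C, G = star C * C) := by
  obtain ⟨R, hR⟩ := CStarAlgebra.nonneg_iff_eq_star_mul_self.1 (CFC.negPart_nonneg G)
  refine ⟨G⁻, R, (IsSelfAdjoint.of_nonneg (CFC.negPart_nonneg G)).star_eq, hR, ?_, fun h => ?_⟩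
  · have h : (G⁺ - G⁻) * G⁻ = -(G⁻ * G⁻) := by
      rw [sub_mul, CFC.posPart_mul_negPart, zero_sub]
    rwa [CFC.posPart_sub_negPart G hG] at h
  · exact CStarAlgebra.nonneg_iff_eq_star_mul_self.1
      (CStarAlgebra.nonneg_iff_isSelfAdjoint_and_negPart_eq_zero.2 ⟨hG, h⟩)

theorem rinner_sum_op_smul {ι : Type*} [Fintype ι] (x : ι → X) (a : ι → A) :
    rinner A (∑ i, op (a i) • x i) (∑ i, op (a i) • x i) =
      ∑ i, ∑ j, star (a i) * (rinner A (x i) (x j) * a j) := by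
  have h : inner Aᵐᵒᵖ (∑ i, op (a i) • x i) (∑ i, op (a i) • x i) =
      ∑ i, ∑ j, op (a j) * (inner Aᵐᵒᵖ (x i) (x j) * star (op (a i))) := by
    rw [CStarModule.inner_sum_left]
    refine Finset.sum_congr rfl fun i _ => ?_
    rw [CStarModule.inner_sum_right]
    refine Finset.sum_congr rfl fun j _ => ?_
    rw [CStarModule.inner_op_smul_left, CStarModule.inner_op_smul_right, mul_assoc]
  rw [rinner, h, Finset.unop_sum]
  refine Finset.sum_congr rfl fun i _ => ?_
  rw [Finset.unop_sum]
  refine Finset.sum_congr rfl fun j _ => ?_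
  simp only [rinner, unop_mul, unop_op, unop_star, mul_assoc]

/-- Gram matrices are positive. -/
theorem gram_nonneg {ι : Type*} [Fintype ι] (x : ι → X) :
    ∃ C : ι → ι → A, ∀ i j, rinner A (x i) (x j) = ∑ k, star (C k i) * C k j := by
  classical
  let G : CStarMatrix ι ι A := CStarMatrix.ofMatrix fun i j => rinner A (x i) (x j)
  have hG : IsSelfAdjoint G := by
    ext i j
    change star (unop (inner Aᵐᵒᵖ (x j) (x i))) = unop (inner Aᵐᵒᵖ (x i) (x j))
    rw [← unop_star, CStarModule.star_inner]
  obtain ⟨H, R, hHsa, hR, hGH, hC⟩ := exists_negPart hG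
  have h1 : star H * (G * H) + star (R * H) * (R * H) = 0 := by
    rw [hGH, star_mul, hHsa, mul_neg, mul_assoc, ← mul_assoc (star R), ← hR, neg_add_cancel]
  have hpos : ∀ k, (0 : A) ≤ (star H * (G * H)) k k := fun k => by
    have : (star H * (G * H)) k k =
        rinner A (∑ i, op (H i k) • x i) (∑ i, op (H i k) • x i) := by
      rw [rinner_sum_op_smul, CStarMatrix.mul_apply]
      refine Finset.sum_congr rfl fun i _ => ?_
      rw [CStarMatrix.mul_apply, Finset.mul_sum]
      rfl
    rw [this]
    exact CStarModule.inner_self_nonneg (A := Aᵐᵒᵖ)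
  have hz : R * H = 0 := by
    ext l k
    have h2 : (star H * (G * H)) k k + ∑ l, star ((R * H) l k) * (R * H) l k = 0 := by
      have h := congrArg (fun M : CStarMatrix ι ι A => M k k) h1
      have h' : (star (R * H) * (R * H)) k k = ∑ l, star ((R * H) l k) * (R * H) l k :=
        CStarMatrix.mul_apply
      rw [← h']
      exact h
    have h3 : ∑ l, star ((R * H) l k) * (R * H) l k = 0 :=
      ((add_eq_zero_iff_of_nonneg (hpos k)
        (Finset.sum_nonneg fun l _ => star_mul_self_nonneg _)).1 h2).2
    have h4 := (Finset.sum_eq_zero_iff_of_nonneg fun l _ => star_mul_self_nonneg _).1 h3 l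
      (Finset.mem_univ l)
    exact CStarRing.star_mul_self_eq_zero_iff _ |>.1 h4
  have hHH : star H * H = 0 := by
    rw [hHsa]
    nth_rewrite 1 [hR]
    rw [mul_assoc, hz, mul_zero]
  obtain ⟨C, hC⟩ := hC (CStarRing.star_mul_self_eq_zero_iff _ |>.1 hHH)
  refine ⟨fun k i => C k i, fun i j => ?_⟩
  have h := congrArg (fun M : CStarMatrix ι ι A => M i j) hC
  exact h.trans CStarMatrix.mul_apply

variable (X) in
/-- The `B`-valued form on `X ⊗ Y` with `⟨x ⊗ y | x' ⊗ y'⟩ = ⟨y | ψ(⟨x | x'⟩_A) y'⟩_B`. -/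
def form (ψ : A →⋆ₙₐ[ℂ] LOp B Y) :
    X ⊗[ℂ] Y →ₗ⋆[ℂ] X ⊗[ℂ] Y →ₗ[ℂ] Bᵐᵒᵖ :=
  TensorProduct.lift (LinearMap.mk₂'ₛₗ (starRingEnd ℂ) (starRingEnd ℂ)
    (fun (x : X) (y : Y) => TensorProduct.lift (LinearMap.mk₂ ℂ
      (fun (x' : X) (y' : Y) => inner Bᵐᵒᵖ y (ψ (rinner A x x') y'))
      (fun x₁ x₂ y' => by simp [rinner])
      (fun c x' y' => by simp [rinner])
      (fun x' y₁ y₂ => by simp)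
      (fun c x' y' => by simp)))
    (fun x₁ x₂ y => TensorProduct.ext' fun x' y' => by simp [rinner])
    (fun c x y => TensorProduct.ext' fun x' y' => by simp [rinner])
    (fun x y₁ y₂ => TensorProduct.ext' fun x' y' => CStarModule.inner_add_left)
    (fun c x y => TensorProduct.ext' fun x' y' => CStarModule.inner_smul_left_complex))

variable (ψ : A →⋆ₙₐ[ℂ] LOp B Y)

theorem form_tmul (x x' : X) (y y' : Y) :
    form X ψ (x ⊗ₜ y) (x' ⊗ₜ y') = inner Bᵐᵒᵖ y (ψ (rinner A x x') y') := rfl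

theorem star_form (z w : X ⊗[ℂ] Y) : star (form X ψ z w) = form X ψ w z := by
  induction z with
  | zero => simp
  | add z z' h h' => simp [h, h']
  | tmul x y =>
    induction w with
    | zero => simp
    | add w w' h h' => simp [h, h']
    | tmul x' y' =>
      rw [form_tmul, form_tmul, CStarModule.star_inner, ← LOp.inner_star_right, ← map_star]
      congr 4
      change star (unop (inner Aᵐᵒᵖ x x')) = unop (inner Aᵐᵒᵖ x' x)
      rw [← unop_star, CStarModule.star_inner]

theorem form_self_nonneg (z : X ⊗[ℂ] Y) : 0 ≤ form X ψ z z := by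
  obtain ⟨S, rfl⟩ := TensorProduct.exists_finset z
  obtain ⟨C, hC⟩ := gram_nonneg (A := A) fun i : S => i.1.1
  rw [← Finset.sum_coe_sort]
  have : form X ψ (∑ i : S, i.1.1 ⊗ₜ[ℂ] i.1.2) (∑ i : S, i.1.1 ⊗ₜ[ℂ] i.1.2) =
      ∑ k, inner Bᵐᵒᵖ (∑ i : S, ψ (C k i) i.1.2) (∑ i : S, ψ (C k i) i.1.2) := by
    simp only [map_sum, LinearMap.sum_apply, form_tmul, hC, CStarModule.inner_sum_left,
      CStarModule.inner_sum_right]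
    have h : ∀ i j : S, inner Bᵐᵒᵖ i.1.2 ((∑ k, ψ (star (C k i) * C k j)) j.1.2) =
        ∑ k, inner Bᵐᵒᵖ (ψ (C k i) i.1.2) (ψ (C k j) j.1.2) := fun i j => by
      rw [LOp.sum_apply, CStarModule.inner_sum_right]
      refine Finset.sum_congr rfl fun k _ => ?_
      rw [map_mul, map_star, ← LOp.inner_star_right]
      rfl
    simp only [h]
    calc ∑ j : S, ∑ i : S, ∑ k, inner Bᵐᵒᵖ (ψ (C k i) i.1.2) (ψ (C k j) j.1.2)
        = ∑ j : S, ∑ k, ∑ i : S, inner Bᵐᵒᵖ (ψ (C k i) i.1.2) (ψ (C k j) j.1.2) :=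
          Finset.sum_congr rfl fun i _ => Finset.sum_comm
      _ = ∑ k, ∑ j : S, ∑ i : S, inner Bᵐᵒᵖ (ψ (C k i) i.1.2) (ψ (C k j) j.1.2) :=
          Finset.sum_comm
  rw [this]
  exact Finset.sum_nonneg fun k _ => CStarModule.inner_self_nonneg

/-- The right action of `B` on `X ⊗ Y`, through the second factor. -/
def tensorOpSMul (b : Bᵐᵒᵖ) : X ⊗[ℂ] Y →ₗ[ℂ] X ⊗[ℂ] Y :=
  TensorProduct.map LinearMap.id (opSMulL (E := Y) b).toLinearMap

theorem form_op_smul (b : Bᵐᵒᵖ) (z w : X ⊗[ℂ] Y) :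
    form X ψ z (tensorOpSMul b w) = b * form X ψ z w := by
  induction z with
  | zero => simp
  | add z z' h h' => simp [h, h', mul_add]
  | tmul x y =>
    induction w with
    | zero => simp
    | add w w' h h' => simp [h, h', mul_add]
    | tmul x' y' =>
      change inner Bᵐᵒᵖ y (ψ (rinner A x x') (b • y')) = _
      rw [LOp.map_op_smul, CStarModule.inner_op_smul_right]
      rfl

theorem form_op_smul_left (b : Bᵐᵒᵖ) (z w : X ⊗[ℂ] Y) :
    form X ψ (tensorOpSMul b z) w = form X ψ z w * star b := by
  rw [← star_form, form_op_smul, star_mul, star_form]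

theorem form_eq_zero {z : X ⊗[ℂ] Y} (hz : form X ψ z z = 0) : form X ψ z = 0 := by
  refine LinearMap.ext fun w => ?_
  set c := form X ψ z w with hc
  have hcs : form X ψ w z = star c := by rw [hc, star_form]
  have key : ∀ t : ℝ, 0 ≤ t → 2 * t * (‖c‖ * ‖c‖) ≤ ‖form X ψ w w‖ := fun t ht => by
    have h0 := form_self_nonneg ψ (w - (t : ℂ) • tensorOpSMul c z)
    have h1 : form X ψ (w - (t : ℂ) • tensorOpSMul c z) (w - (t : ℂ) • tensorOpSMul c z) =
        form X ψ w w - ((2 * t : ℝ) : ℂ) • (c * star c) := by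
      simp only [map_sub, map_smulₛₗ, LinearMap.sub_apply, LinearMap.smul_apply, form_op_smul,
        form_op_smul_left, hz, hcs, ← hc, mul_zero, smul_zero, Complex.conj_ofReal, zero_mul,
        RingHom.id_apply]
      push_cast
      rw [mul_smul, ofNat_smul_eq_nsmul, two_smul]
      abel_nf
    rw [h1, sub_nonneg] at h0
    have h2 : (0 : Bᵐᵒᵖ) ≤ ((2 * t : ℝ) : ℂ) • (c * star c) := by
      rw [Complex.coe_smul]
      exact smul_nonneg (by positivity) (mul_star_self_nonneg c)
    have h3 := CStarAlgebra.norm_le_norm_of_nonneg_of_le h2 h0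
    rwa [norm_smul, CStarRing.norm_self_mul_star, Complex.norm_real, Real.norm_of_nonneg
      (by positivity)] at h3
  by_contra hne
  have hcpos : 0 < ‖c‖ := norm_pos_iff.2 hne
  have := key ((‖form X ψ w w‖ + 1) / (2 * (‖c‖ * ‖c‖))) (by positivity)
  have h5 : 2 * ((‖form X ψ w w‖ + 1) / (2 * (‖c‖ * ‖c‖))) * (‖c‖ * ‖c‖) =
      ‖form X ψ w w‖ + 1 := by field_simp
  linarith

variable (X) in
/-- The quotient of the algebraic tensor product `X ⊗ Y` by the null vectors of the form. (The
balancing relations `x · a ⊗ y = x ⊗ ψ(a) y` hold in this quotient.) -/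
def PreTensor : Type _ := (X ⊗[ℂ] Y) ⧸ LinearMap.ker (form X ψ)

instance : AddCommGroup (PreTensor X ψ) :=
  inferInstanceAs (AddCommGroup ((X ⊗[ℂ] Y) ⧸ LinearMap.ker (form X ψ)))

instance : Module ℂ (PreTensor X ψ) :=
  inferInstanceAs (Module ℂ ((X ⊗[ℂ] Y) ⧸ LinearMap.ker (form X ψ)))

/-- The quotient map. -/
def preMk : X ⊗[ℂ] Y →ₗ[ℂ] PreTensor X ψ := Submodule.mkQ (LinearMap.ker (form X ψ))

theorem preMk_surjective : Function.Surjective (preMk (X := X) ψ) := Submodule.mkQ_surjective _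

theorem form_congr {z z' w w' : X ⊗[ℂ] Y} (hz : preMk ψ z = preMk ψ z')
    (hw : preMk ψ w = preMk ψ w') : form X ψ z w = form X ψ z' w' := by
  have h1 : form X ψ z = form X ψ z' := by
    have := (Submodule.Quotient.eq (LinearMap.ker (form X ψ))).1 hz
    rwa [LinearMap.mem_ker, map_sub, sub_eq_zero] at this
  have h2 : form X ψ w = form X ψ w' := by
    have := (Submodule.Quotient.eq (LinearMap.ker (form X ψ))).1 hw
    rwa [LinearMap.mem_ker, map_sub, sub_eq_zero] at this
  rw [h1, ← star_form, h2, star_form]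

instance : SMul Bᵐᵒᵖ (PreTensor X ψ) where
  smul b := Submodule.mapQ (LinearMap.ker (form X ψ)) (LinearMap.ker (form X ψ)) (tensorOpSMul b)
    fun z hz => by
      rw [Submodule.mem_comap, LinearMap.mem_ker]
      refine LinearMap.ext fun w => ?_
      rw [form_op_smul_left, LinearMap.mem_ker.1 hz]
      exact zero_mul _

theorem op_smul_preMk (b : Bᵐᵒᵖ) (z : X ⊗[ℂ] Y) :
    b • preMk ψ z = preMk ψ (tensorOpSMul b z) := rfl

/-- The inner product induced by the form on the quotient. -/
def preInner (u v : PreTensor X ψ) : Bᵐᵒᵖ :=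
  form X ψ (preMk_surjective ψ u).choose (preMk_surjective ψ v).choose

theorem preInner_preMk (z w : X ⊗[ℂ] Y) :
    preInner ψ (preMk ψ z) (preMk ψ w) = form X ψ z w :=
  form_congr ψ (preMk_surjective ψ _).choose_spec (preMk_surjective ψ _).choose_spec

instance : Norm (PreTensor X ψ) where
  norm u := √‖preInner ψ u u‖

instance : CStarModule Bᵐᵒᵖ (PreTensor X ψ) where
  inner := preInner ψ
  inner_add_right {u v w} := by
    obtain ⟨u, rfl⟩ := preMk_surjective ψ u
    obtain ⟨v, rfl⟩ := preMk_surjective ψ v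
    obtain ⟨w, rfl⟩ := preMk_surjective ψ w
    rw [← map_add, preInner_preMk, preInner_preMk, preInner_preMk, map_add]
  inner_self_nonneg {u} := by
    obtain ⟨u, rfl⟩ := preMk_surjective ψ u
    rw [preInner_preMk]
    exact form_self_nonneg ψ u
  inner_self {u} := by
    obtain ⟨u, rfl⟩ := preMk_surjective ψ u
    rw [preInner_preMk]
    refine ⟨fun h => (Submodule.Quotient.mk_eq_zero _).2 (form_eq_zero ψ h), fun h => ?_⟩
    have : form X ψ u = 0 := (Submodule.Quotient.mk_eq_zero (LinearMap.ker (form X ψ))).1 h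
    rw [this, LinearMap.zero_apply]
  inner_op_smul_right {b u v} := by
    obtain ⟨u, rfl⟩ := preMk_surjective ψ u
    obtain ⟨v, rfl⟩ := preMk_surjective ψ v
    rw [op_smul_preMk, preInner_preMk, preInner_preMk, form_op_smul]
  inner_smul_right_complex {c u v} := by
    obtain ⟨u, rfl⟩ := preMk_surjective ψ u
    obtain ⟨v, rfl⟩ := preMk_surjective ψ v
    rw [← map_smul, preInner_preMk, preInner_preMk, map_smul]
  star_inner u v := by
    obtain ⟨u, rfl⟩ := preMk_surjective ψ u
    obtain ⟨v, rfl⟩ := preMk_surjective ψ v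
    rw [preInner_preMk, preInner_preMk, star_form]
  norm_eq_sqrt_norm_inner_self _ := rfl

theorem inner_preMk (z w : X ⊗[ℂ] Y) :
    inner Bᵐᵒᵖ (preMk ψ z) (preMk ψ w) = form X ψ z w := preInner_preMk ψ z w

instance : NormedAddCommGroup (PreTensor X ψ) := CStarModule.normedAddCommGroup Bᵐᵒᵖ

instance : NormedSpace ℂ (PreTensor X ψ) := .ofCore (CStarModule.normedSpaceCore Bᵐᵒᵖ)

variable (X) in
/-- The interior tensor product `X ⊗_A Y`, a right Hilbert `B`-module. -/
abbrev Tensor : Type _ := UniformSpace.Completion (PreTensor X ψ)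

/-- The elementary tensor `x ⊗ y` in `X ⊗_A Y`. -/
def tmul (x : X) (y : Y) : Tensor X ψ := ((preMk ψ (x ⊗ₜ[ℂ] y) : PreTensor X ψ) : Tensor X ψ)

theorem inner_tmul (x x' : X) (y y' : Y) :
    rinner B (tmul ψ x y) (tmul ψ x' y') = rinner B y (ψ (rinner A x x') y') := by
  unfold rinner
  rw [tmul, tmul, completion_inner_coe, inner_preMk, form_tmul]
  rfl

/-- The operator `T ⊗ 1` on the algebraic tensor product. -/
def algMap (T : LOp A X) : X ⊗[ℂ] Y →ₗ[ℂ] X ⊗[ℂ] Y :=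
  TensorProduct.map T.toCLM.toLinearMap LinearMap.id

theorem form_algMap (T : LOp A X) (z w : X ⊗[ℂ] Y) :
    form X ψ z (algMap (star T) w) = form X ψ (algMap T z) w := by
  induction z with
  | zero => simp
  | add z z' h h' => simp [h, h']
  | tmul x y =>
    induction w with
    | zero => simp
    | add w w' h h' => simp [h, h']
    | tmul x' y' =>
      change inner Bᵐᵒᵖ y ((ψ (rinner A x (star T x'))) y') =
        inner Bᵐᵒᵖ y (ψ (rinner A (T x) x') y')
      rw [rinner_eq_iff.2 (LOp.inner_star_right T x x')]

/-- The operator `T ⊗ 1` on the quotient by null vectors. -/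
def preMap (T : LOp A X) : PreTensor X ψ →ₗ[ℂ] PreTensor X ψ :=
  Submodule.mapQ (LinearMap.ker (form X ψ)) (LinearMap.ker (form X ψ)) (algMap T) fun z hz => by
    rw [Submodule.mem_comap, LinearMap.mem_ker]
    refine LinearMap.ext fun w => ?_
    rw [← form_algMap, LinearMap.mem_ker.1 hz, LinearMap.zero_apply, LinearMap.zero_apply]

theorem preMap_preMk (T : LOp A X) (z : X ⊗[ℂ] Y) :
    preMap ψ T (preMk ψ z) = preMk ψ (algMap T z) := rfl

theorem inner_preMap (T : LOp A X) (u v : PreTensor X ψ) :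
    inner Bᵐᵒᵖ u (preMap ψ (star T) v) = inner Bᵐᵒᵖ (preMap ψ T u) v := by
  obtain ⟨u, rfl⟩ := preMk_surjective ψ u
  obtain ⟨v, rfl⟩ := preMk_surjective ψ v
  rw [preMap_preMk, preMap_preMk, inner_preMk, inner_preMk, form_algMap]

theorem preMap_ext {f g : PreTensor X ψ →ₗ[ℂ] PreTensor X ψ}
    (h : ∀ (x : X) (y : Y), f (preMk ψ (x ⊗ₜ y)) = g (preMk ψ (x ⊗ₜ y))) : f = g := by
  have : f ∘ₗ preMk ψ = g ∘ₗ preMk ψ := TensorProduct.ext' h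
  ext u
  obtain ⟨u, rfl⟩ := preMk_surjective ψ u
  exact LinearMap.congr_fun this u

theorem preMap_add (S T : LOp A X) : preMap ψ (S + T) = preMap ψ S + preMap ψ T :=
  preMap_ext ψ fun x y => by
    change preMk ψ ((S x + T x) ⊗ₜ y) = preMk ψ (S x ⊗ₜ y) + preMk ψ (T x ⊗ₜ y)
    rw [TensorProduct.add_tmul, map_add]

theorem preMap_smul (c : ℂ) (T : LOp A X) : preMap ψ (c • T) = c • preMap ψ T :=
  preMap_ext ψ fun x y => by
    change preMk ψ ((c • T x) ⊗ₜ y) = c • preMk ψ (T x ⊗ₜ y)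
    rw [← TensorProduct.smul_tmul', map_smul]

theorem preMap_mul (S T : LOp A X) : preMap ψ (S * T) = preMap ψ S ∘ₗ preMap ψ T :=
  preMap_ext ψ fun _ _ => rfl

theorem preMap_one : preMap ψ (1 : LOp A X) = LinearMap.id :=
  preMap_ext ψ fun _ _ => rfl

theorem norm_preMap_le (T : LOp A X) (u : PreTensor X ψ) :
    ‖preMap ψ T u‖ ≤ ‖T‖ * ‖u‖ := by
  obtain ⟨S, hS⟩ : ∃ S : LOp A X,
      star T * T + star S * S = ((‖T‖ ^ 2 : ℝ) : ℂ) • (1 : LOp A X) := by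
    let _ := CStarAlgebra.spectralOrder (LOp A X)
    have _ := CStarAlgebra.spectralOrderedRing (LOp A X)
    have h := CStarAlgebra.star_mul_le_algebraMap_norm_sq (a := T)
    obtain ⟨S, hS⟩ := CStarAlgebra.nonneg_iff_eq_star_mul_self.1 (sub_nonneg.2 h)
    refine ⟨S, ?_⟩
    rw [← hS, add_sub_cancel, Algebra.algebraMap_eq_smul_one, Complex.coe_smul]
  have h1 : inner Bᵐᵒᵖ (preMap ψ T u) (preMap ψ T u) + inner Bᵐᵒᵖ (preMap ψ S u) (preMap ψ S u) =
      ((‖T‖ ^ 2 : ℝ) : ℂ) • inner Bᵐᵒᵖ u u := by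
    rw [← inner_preMap, ← inner_preMap, ← CStarModule.inner_add_right,
      ← LinearMap.comp_apply, ← LinearMap.comp_apply, ← preMap_mul, ← preMap_mul,
      ← LinearMap.add_apply, ← preMap_add, hS, preMap_smul, preMap_one, LinearMap.smul_apply,
      LinearMap.id_apply, CStarModule.inner_smul_right_complex]
  have h2 : inner Bᵐᵒᵖ (preMap ψ T u) (preMap ψ T u) ≤ ((‖T‖ ^ 2 : ℝ) : ℂ) • inner Bᵐᵒᵖ u u := by
    rw [← h1]
    exact le_add_of_nonneg_right CStarModule.inner_self_nonneg
  have h3 := CStarAlgebra.norm_le_norm_of_nonneg_of_le CStarModule.inner_self_nonneg h2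
  rw [← CStarModule.norm_sq_eq, norm_smul, ← CStarModule.norm_sq_eq, Complex.norm_real,
    Real.norm_of_nonneg (by positivity), ← mul_pow] at h3
  exact le_of_sq_le_sq h3 (by positivity)

/-- The bounded operator `T ⊗ 1` on the quotient by null vectors. -/
def preMapL (T : LOp A X) : PreTensor X ψ →L[ℂ] PreTensor X ψ :=
  LinearMap.mkContinuous (preMap ψ T) ‖T‖ (norm_preMap_le ψ T)

theorem preMapL_apply (T : LOp A X) (u : PreTensor X ψ) :
    preMapL ψ T u = preMap ψ T u := rfl

theorem completion_ext {f g : Tensor X ψ →L[ℂ] Tensor X ψ}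
    (h : ∀ u : PreTensor X ψ, f u = g u) : f = g :=
  ContinuousLinearMap.ext fun z => UniformSpace.Completion.induction_on z
    (isClosed_eq f.continuous g.continuous) h

theorem inner_completion_preMapL (T : LOp A X) (z w : Tensor X ψ) :
    inner Bᵐᵒᵖ ((preMapL ψ T).completion z) w =
      inner Bᵐᵒᵖ z ((preMapL ψ (star T)).completion w) :=
  UniformSpace.Completion.induction_on₂ z w
    (isClosed_eq
      (completion_continuous_inner' ((preMapL ψ T).completion.continuous.comp continuous_fst)
        continuous_snd)
      (completion_continuous_inner' continuous_fst
        ((preMapL ψ (star T)).completion.continuous.comp continuous_snd)))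
    fun u v => by
      rw [ContinuousLinearMap.completion_apply_coe, ContinuousLinearMap.completion_apply_coe,
        completion_inner_coe, completion_inner_coe, preMapL_apply, preMapL_apply, inner_preMap]

variable (X) in
/-- The *-homomorphism `L_A(X) → L_B(X ⊗_A Y)`, `T ↦ T ⊗ 1`. -/
def tensorOne : LOp A X →⋆ₙₐ[ℂ] LOp B (Tensor X ψ) where
  toFun T := ⟨(preMapL ψ T).completion, (preMapL ψ (star T)).completion, fun z w =>
    congrArg unop (inner_completion_preMapL ψ T z w)⟩
  map_smul' c T := Subtype.ext (completion_ext ψ fun u => by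
    change (preMapL ψ (c • T)).completion u = c • (preMapL ψ T).completion u
    simp only [ContinuousLinearMap.completion_apply_coe, preMapL_apply, preMap_smul]
    rw [← UniformSpace.Completion.coe_smul]
    rfl)
  map_zero' := Subtype.ext (completion_ext ψ fun u => by
    change (preMapL (X := X) ψ 0).completion u = 0
    have h : preMap ψ (0 : LOp A X) = 0 := by
      have h0 := preMap_smul ψ 0 (0 : LOp A X)
      rwa [zero_smul, zero_smul] at h0
    rw [ContinuousLinearMap.completion_apply_coe, preMapL_apply, h, LinearMap.zero_apply,
      UniformSpace.Completion.coe_zero])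
  map_add' S T := Subtype.ext (completion_ext ψ fun u => by
    change (preMapL ψ (S + T)).completion u =
      (preMapL ψ S).completion u + (preMapL ψ T).completion u
    simp only [ContinuousLinearMap.completion_apply_coe, preMapL_apply, preMap_add]
    rw [← UniformSpace.Completion.coe_add]
    rfl)
  map_mul' S T := Subtype.ext (completion_ext ψ fun u => by
    change (preMapL ψ (S * T)).completion u =
      (preMapL ψ S).completion ((preMapL ψ T).completion u)
    simp only [ContinuousLinearMap.completion_apply_coe, preMapL_apply, preMap_mul]
    rfl)
  map_star' T := LOp.eq_star (inner_completion_preMapL ψ T)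

theorem tensorOne_tmul (T : LOp A X) (x : X) (y : Y) :
    tensorOne X ψ T (tmul ψ x y) = tmul ψ (T x) y := by
  change (preMapL ψ T).completion _ = _
  rw [tmul, ContinuousLinearMap.completion_apply_coe]
  rfl

/-- `ψ : A → L_B(Y)` is nondegenerate if `ψ(A) Y` has dense span in `Y`. -/
def IsNondegenerate : Prop :=
  Dense (Submodule.span ℂ {z : Y | ∃ (a : A) (y : Y), ψ a y = z} : Set Y)

/-- `ψ : A → L_B(Y)` viewed as a *-homomorphism `A → M(K_B(Y))`. -/
def toMor : A →⋆ₙₐ[ℂ] 𝓜(ℂ, compacts B Y) :=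
  toMultiplier.comp ψ

variable (X) in
/-- The map `λ : K_A(X) → M(K_B(X ⊗_A Y))`, `T ↦ T ⊗ 1`. -/
def lam : compacts A X →⋆ₙₐ[ℂ] 𝓜(ℂ, compacts B (Tensor X ψ)) :=
  (toMor (tensorOne X ψ)).comp KOp.incl

end Tensor

end HilbertCorr

end

open HilbertCorr

noncomputable section

namespace HilbertCorr

open Filter Topology

/-! ### Ideals and approximate units -/

section Ideals

variable {A B : Type*} [NonUnitalCStarAlgebra A] [NonUnitalCStarAlgebra B]

/-! Everything is read off from the coefficients ⟨x | K y⟩ of a compact operator K. The identity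
Θ_{x,y} T Θ_{z,w} = Θ_{x·⟨y|Tz⟩, w} (`theta_mul_mul_theta`), together with an approximate unit of
K_A(X), shows that K lies in K_A(X·I) exactly when all its coefficients lie in I
(`mem_compactsIdeal_iff`). The same identity recovers an ideal J of K_A(X) from the ideal of those a
with every Θ_{x·a,y} in J. Fullness supplies the other composite, since Θ_{y·a,z} has coefficients
⟨x|y⟩ a ⟨z|w⟩. This gives the lattice isomorphism `IsFull.idealIso`.

The link with λ is made by the creation operators t_x : y ↦ x ⊗ y. They satisfy t_x* (T ⊗ 1) t_x' =
ψ(⟨x | T x'⟩) and t_x ψ(a) t_y* = Θ_{x·a,y} ⊗ 1 (`sandwich_tensorOne`, `tensorOne_theta_op_smul`).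
Multiplying by adjointable operators on both sides preserves compactness, so the two formulas give
the two inclusions for pim(λ); the first formula and a norm computation give ker(λ).

The rest is order theory. I^⊥ is the largest ideal meeting I in zero, so lattice isomorphisms
preserve annihilators and hence Katsura ideals. An ideal is proper iff it lies below pim and perfect
iff it lies below kat, so both families are principal down-sets: they are sublattices, and the
isomorphism carries them to each other. That λ is a morphism follows from the density of the span of
the vectors Θ_{x,y} z in X. -/

/-- A self-adjoint approximate unit bounded by one, without reference to an order. -/
theorem exists_approximateUnit (A : Type*) [NonUnitalCStarAlgebra A] :
    ∃ l : Filter A, l.NeBot ∧ (∀ a, Tendsto (fun e => a * e) l (𝓝 a)) ∧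
      (∀ a, Tendsto (fun e => e * a) l (𝓝 a)) ∧
      ∀ᶠ e in l, star e = e ∧ ‖e‖ ≤ 1 := by
  -- The increasing approximate unit refers to an order; the spectral one is chosen locally and
  -- leaves no trace in the conclusion.
  let _ := CStarAlgebra.spectralOrder A
  have _ := CStarAlgebra.spectralOrderedRing A
  have h := CStarAlgebra.increasingApproximateUnit A
  exact ⟨CStarAlgebra.approximateUnit A, h.neBot, h.tendsto_mul_left, h.tendsto_mul_right,
    h.eventually_star_eq.and h.eventually_norm⟩

/-- A closed set containing `c * a * d` for all `c`, `d` contains `a`. -/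
theorem mem_of_forall_mul_mul_mem {S : Set A} (hS : IsClosed S) {a : A}
    (h : ∀ c d, c * a * d ∈ S) : a ∈ S := by
  obtain ⟨l, hl, h1, h2, -⟩ := exists_approximateUnit A
  -- The two limits are taken one at a time: the right factor converges with the left one fixed.
  refine hS.mem_of_tendsto (h2 a) (Eventually.of_forall fun c => ?_)
  exact hS.mem_of_tendsto (h1 (c * a)) (Eventually.of_forall fun d => h c d)

theorem ClosedIdeal.isClosed (I : ClosedIdeal A) : IsClosed (I : Set A) := I.isClosed'

namespace ClosedIdeal

variable (I : ClosedIdeal A)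

theorem zero_mem : (0 : A) ∈ I := I.zero_mem'

theorem add_mem {a b : A} (ha : a ∈ I) (hb : b ∈ I) : a + b ∈ I := I.add_mem' ha hb

theorem smul_mem (z : ℂ) {a : A} (ha : a ∈ I) : z • a ∈ I := I.smul_mem' z ha

theorem mul_mem_left (a : A) {b : A} (hb : b ∈ I) : a * b ∈ I := I.mul_mem_left' a hb

theorem mul_mem_right (a : A) {b : A} (hb : b ∈ I) : b * a ∈ I := I.mul_mem_right' a hb

/-- The C*-subalgebra `I ∩ I*`. -/
def selfAdjointPart : NonUnitalStarSubalgebra ℂ A where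
  carrier := {a | a ∈ I ∧ star a ∈ I}
  add_mem' ha hb := ⟨I.add_mem ha.1 hb.1, by rw [star_add]; exact I.add_mem ha.2 hb.2⟩
  zero_mem' := ⟨I.zero_mem, by rw [star_zero]; exact I.zero_mem⟩
  mul_mem' ha hb := ⟨I.mul_mem_left _ hb.1, by rw [star_mul]; exact I.mul_mem_left _ ha.2⟩
  smul_mem' z _ ha := ⟨I.smul_mem z ha.1, by rw [star_smul]; exact I.smul_mem _ ha.2⟩
  star_mem' ha := ⟨ha.2, by rw [star_star]; exact ha.1⟩

/-- Closedness gives completeness, so that I ∩ I* is itself a C*-algebra and has an approximate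
unit. -/
instance : IsClosed (I.selfAdjointPart : Set A) :=
  I.isClosed.inter (I.isClosed.preimage continuous_star)

/-- A self-adjoint element of an ideal is approximated by its products with self-adjoint
contractions in the ideal. -/
theorem exists_norm_sub_mul_lt {p : A} (hp : p ∈ I) (hps : star p = p) {ε : ℝ} (hε : 0 < ε) :
    ∃ e ∈ I, star e = e ∧ ‖e‖ ≤ 1 ∧ ‖p - p * e‖ < ε := by
  -- Invariance under the involution is not part of the definition of `ClosedIdeal`; the approximate
  -- unit is taken in I ∩ I*, which contains the self-adjoint p.
  obtain ⟨l, hl, h1, -, h3⟩ := exists_approximateUnit I.selfAdjointPart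
  let q : I.selfAdjointPart := ⟨p, hp, by rwa [hps]⟩
  obtain ⟨e, he, hs, hn⟩ := (((h1 q).eventually (Metric.ball_mem_nhds q hε)).and h3).exists
  refine ⟨e, e.2.1, congrArg Subtype.val hs, hn, ?_⟩
  have he' : ‖q * e - q‖ < ε := by rw [← dist_eq_norm]; exact he
  rw [norm_sub_rev]
  exact he'

/-- Characterises the annihilator by order alone, as the largest ideal with zero meet with J. One
direction is the C*-identity, the other is that a product ab with a in I and b in J lies in both
ideals. -/
theorem le_annihilator_iff {I J : ClosedIdeal A} : I ≤ J.annihilator ↔ I ⊓ J = ⊥ := by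
  constructor
  · intro h
    refine eq_bot_iff.2 fun a ha => ?_
    have ha1 : a ∈ I := (inf_le_left : I ⊓ J ≤ I) ha
    have ha2 : a ∈ J := (inf_le_right : I ⊓ J ≤ J) ha
    -- The element `star a * a` lies in J as a left multiple of a, so it need not be known that J is
    -- closed under the involution. The C*-identity is then applied twice.
    have h1 : a * (star a * a) = 0 := h ha1 _ (J.mul_mem_left _ ha2)
    have h2 : star (star a * a) * (star a * a) = 0 := by
      rw [star_mul, star_star, mul_assoc, h1, mul_zero]
    have h3 : a = 0 := CStarRing.star_mul_self_eq_zero_iff _ |>.1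
      (CStarRing.star_mul_self_eq_zero_iff _ |>.1 h2)
    rw [h3]
    exact zero_mem _
  · intro h a ha b hb
    have h1 : a * b ∈ I ⊓ J := by
      -- Meets come from the complete lattice structure; the concrete intersection is compared with
      -- the meet through its universal property. The zero ideal below plays the same role for ⊥.
      let K : ClosedIdeal A :=
        { I.toSubmodule ⊓ J.toSubmodule with
          mul_mem_left' := fun c _ hd => ⟨I.mul_mem_left c hd.1, J.mul_mem_left c hd.2⟩
          mul_mem_right' := fun c hd => ⟨I.mul_mem_right c hd.1, J.mul_mem_right c hd.2⟩
          isClosed' := I.isClosed.inter J.isClosed }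
      have hK : K ≤ I ⊓ J := le_inf (fun _ h => h.1) (fun _ h => h.2)
      exact hK ⟨I.mul_mem_right b ha, J.mul_mem_left a hb⟩
    rw [h] at h1
    let K : ClosedIdeal A :=
      { (⊥ : Submodule ℂ A) with
        mul_mem_left' := fun c d hd => by
          rw [show d = 0 from hd, mul_zero]; rfl
        mul_mem_right' := fun {d} c hd => by
          rw [show d = 0 from hd, zero_mul]; rfl
        isClosed' := isClosed_singleton }
    exact (bot_le : ⊥ ≤ K) h1

end ClosedIdeal

/-- The ideals below an annihilator are singled out by a condition on meets and ⊥, which order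
isomorphisms respect. -/
theorem _root_.OrderIso.map_annihilator (e : ClosedIdeal A ≃o ClosedIdeal B) (I : ClosedIdeal A) :
    e I.annihilator = (e I).annihilator := by
  refine eq_of_forall_le_iff fun J => ?_
  obtain ⟨J, rfl⟩ := e.surjective J
  rw [e.le_iff_le, ClosedIdeal.le_annihilator_iff, ClosedIdeal.le_annihilator_iff, ← e.map_inf,
    ← e.map_bot, e.injective.eq_iff]

/-! ### Proper and perfect ideals as principal down-sets -/

theorem isProperFor_iff_le_pim (φ : A →⋆ₙₐ[ℂ] 𝓜(ℂ, B)) (J : ClosedIdeal A) :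
    IsProperFor φ J ↔ J ≤ pim φ := Iff.rfl

/-- Injectivity on J amounts to J ∩ ker φ = 0, that is, to J lying below the annihilator of the
kernel. -/
theorem isPerfectFor_iff_le_kat (φ : A →⋆ₙₐ[ℂ] 𝓜(ℂ, B)) (J : ClosedIdeal A) :
    IsPerfectFor φ J ↔ J ≤ kat φ := by
  rw [kat, le_inf_iff, ← isProperFor_iff_le_pim, IsPerfectFor]
  refine and_congr_right fun _ => ?_
  rw [ClosedIdeal.le_annihilator_iff]
  constructor
  · intro h
    refine eq_bot_iff.2 fun a ha => ?_
    have ha1 : a ∈ J := (inf_le_left : J ⊓ ker φ ≤ J) ha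
    have ha2 : φ a = 0 := (inf_le_right : J ⊓ ker φ ≤ ker φ) ha
    rw [h ha1 J.zero_mem (by rw [ha2, map_zero])]
    exact ClosedIdeal.zero_mem _
  · intro h a ha b hb hab
    have h1 : J ≤ (ker φ).annihilator := ClosedIdeal.le_annihilator_iff.2 h
    have h2 : a - b ∈ J := J.toSubmodule.sub_mem ha hb
    -- The adjoint of a - b lies in the kernel because φ is a *-homomorphism, and elements of J
    -- annihilate the kernel.
    have h3 : (a - b) * star (a - b) = 0 := h1 h2 _ (show φ _ = 0 by
      rw [map_star, map_sub, hab, sub_self, star_zero])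
    exact sub_eq_zero.1 (CStarRing.mul_star_self_eq_zero_iff _ |>.1 h3)

/-- Turns density into an induction principle: the hypothesis is applied to the closure of the span
of the products φ(a)b. -/
theorem isMorphism_of_forall_closed_submodule {φ : A →⋆ₙₐ[ℂ] 𝓜(ℂ, B)}
    (h : ∀ S : Submodule ℂ B, IsClosed (S : Set B) → (∀ a b, (φ a).fst b ∈ S) → ∀ b, b ∈ S) :
    IsMorphism φ := by
  let S : Submodule ℂ B := Submodule.span ℂ {c : B | ∃ (a : A) (b : B), (φ a).fst b = c}
  exact fun b => h S.topologicalClosure S.isClosed_topologicalClosure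
    (fun a b => S.le_topologicalClosure (Submodule.subset_span ⟨a, b, rfl⟩)) b

theorem isSublattice_Iic {L : Type*} [Lattice L] (a : L) : IsSublattice {b | b ≤ a} :=
  ⟨fun _ hb _ hc => sup_le hb hc, fun _ hb _ _ => inf_le_left.trans hb⟩

theorem setOf_isProperFor (φ : A →⋆ₙₐ[ℂ] 𝓜(ℂ, B)) : {J | IsProperFor φ J} = {J | J ≤ pim φ} :=
  Set.ext (isProperFor_iff_le_pim φ)

theorem setOf_isPerfectFor (φ : A →⋆ₙₐ[ℂ] 𝓜(ℂ, B)) : {J | IsPerfectFor φ J} = {J | J ≤ kat φ} :=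
  Set.ext (isPerfectFor_iff_le_kat φ)

theorem isSublattice_isProperFor (φ : A →⋆ₙₐ[ℂ] 𝓜(ℂ, B)) : IsSublattice {J | IsProperFor φ J} := by
  rw [setOf_isProperFor]
  exact isSublattice_Iic _

theorem isSublattice_isPerfectFor (φ : A →⋆ₙₐ[ℂ] 𝓜(ℂ, B)) :
    IsSublattice {J | IsPerfectFor φ J} := by
  rw [setOf_isPerfectFor]
  exact isSublattice_Iic _

variable {C D : Type*} [NonUnitalCStarAlgebra C] [NonUnitalCStarAlgebra D]

/-- An order isomorphism maps a principal down-set onto the down-set of the image of its top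
element. -/
theorem image_isProperFor (e : ClosedIdeal A ≃o ClosedIdeal C) {φ : A →⋆ₙₐ[ℂ] 𝓜(ℂ, B)}
    {χ : C →⋆ₙₐ[ℂ] 𝓜(ℂ, D)} (h : pim χ = e (pim φ)) :
    e '' {J | IsProperFor φ J} = {J | IsProperFor χ J} := by
  rw [setOf_isProperFor, setOf_isProperFor, h]
  exact e.image_Iic _

theorem image_isPerfectFor (e : ClosedIdeal A ≃o ClosedIdeal C) {φ : A →⋆ₙₐ[ℂ] 𝓜(ℂ, B)}
    {χ : C →⋆ₙₐ[ℂ] 𝓜(ℂ, D)} (h : kat χ = e (kat φ)) :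
    e '' {J | IsPerfectFor φ J} = {J | IsPerfectFor χ J} := by
  rw [setOf_isPerfectFor, setOf_isPerfectFor, h]
  exact e.image_Iic _

end Ideals

/-! ### Hilbert modules -/

section Modules

variable {A X : Type*} [NonUnitalCStarAlgebra A] [PartialOrder A] [StarOrderedRing A]
  [NormedAddCommGroup X] [NormedSpace ℂ X] [SMul Aᵐᵒᵖ X] [CStarModule Aᵐᵒᵖ X]

theorem rinner_op_smul_right (x y : X) (a : A) :
    rinner A x (op a • y) = rinner A x y * a := by
  rw [rinner, CStarModule.inner_op_smul_right, unop_mul, unop_op, rinner]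

theorem rinner_op_smul_left (x y : X) (a : A) :
    rinner A (op a • x) y = star a * rinner A x y := by
  rw [rinner, CStarModule.inner_op_smul_left, unop_mul, unop_star, unop_op, rinner]

theorem star_rinner (x y : X) : star (rinner A x y) = rinner A y x := by
  rw [rinner, ← unop_star, CStarModule.star_inner, rinner]

theorem norm_rinner_self (x : X) : ‖rinner A x x‖ = ‖x‖ ^ 2 := by
  rw [CStarModule.norm_sq_eq Aᵐᵒᵖ]; rfl

theorem norm_rinner_le (x y : X) : ‖rinner A x y‖ ≤ ‖x‖ * ‖y‖ :=
  CStarModule.norm_inner_le (A := Aᵐᵒᵖ) X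

theorem rinner_add_right (x y z : X) : rinner A x (y + z) = rinner A x y + rinner A x z := by
  rw [rinner, CStarModule.inner_add_right]; rfl

theorem rinner_add_left (x y z : X) : rinner A (x + y) z = rinner A x z + rinner A y z := by
  rw [rinner, CStarModule.inner_add_left]; rfl

theorem rinner_sub_right (x y z : X) : rinner A x (y - z) = rinner A x y - rinner A x z := by
  rw [rinner, CStarModule.inner_sub_right]; rfl

theorem rinner_sub_left (x y z : X) : rinner A (x - y) z = rinner A x z - rinner A y z := by
  rw [rinner, CStarModule.inner_sub_left]; rfl

theorem rinner_smul_right (x y : X) (c : ℂ) : rinner A x (c • y) = c • rinner A x y := by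
  rw [rinner, CStarModule.inner_smul_right_complex]; rfl

theorem rinner_zero_right (x : X) : rinner A x (0 : X) = 0 := by
  rw [rinner, CStarModule.inner_zero_right]; rfl

variable (A) in
theorem ext_rinner {x y : X} (h : ∀ w : X, rinner A w x = rinner A w y) : x = y :=
  ext_inner (C := Aᵐᵒᵖ) fun w => rinner_eq_iff.1 (h w)

theorem continuous_rinner : Continuous fun p : X × X => rinner A p.1 p.2 :=
  continuous_unop.comp (CStarModule.continuous_inner (A := Aᵐᵒᵖ))

theorem continuous_rinner_right (x : X) : Continuous fun y : X => rinner A x y :=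
  (continuous_rinner (A := A)).comp (by fun_prop : Continuous fun y : X => (x, y))

theorem op_mul_smul (a b : A) (x : X) : op (a * b) • x = op b • op a • x := by
  rw [op_mul, mul_op_smul]

/-- With p = ⟨x|x⟩, the vector x - x·e has inner square (p - pe) - e(p - pe); the factor 2 comes
from ‖e‖ ≤ 1. -/
theorem ClosedIdeal.norm_sub_op_smul_sq_le (x : X) {e : A} (hs : star e = e) (hn : ‖e‖ ≤ 1) :
    ‖x - op e • x‖ ^ 2 ≤ 2 * ‖rinner A x x - rinner A x x * e‖ := by
  rw [← norm_rinner_self (A := A), rinner_sub_left, rinner_sub_right, rinner_sub_right,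
    rinner_op_smul_left, rinner_op_smul_left, rinner_op_smul_right, hs, ← mul_sub]
  calc _ ≤ ‖rinner A x x - rinner A x x * e‖ + ‖e * (rinner A x x - rinner A x x * e)‖ :=
        norm_sub_le _ _
    _ ≤ ‖rinner A x x - rinner A x x * e‖ + 1 * ‖rinner A x x - rinner A x x * e‖ := by
        gcongr
        exact (norm_mul_le _ _).trans (by gcongr)
    _ = _ := by ring

/-- If `⟨x | x⟩ ∈ I` then `x` is a limit of vectors `x · e` with `e ∈ I` self-adjoint. -/
theorem mem_closure_op_smul (I : ClosedIdeal A) {x : X} (hx : rinner A x x ∈ I) :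
    x ∈ closure {y : X | ∃ e ∈ I, star e = e ∧ op e • x = y} := by
  refine Metric.mem_closure_iff.2 fun ε hε => ?_
  -- The tolerance ε²/2 absorbs the factor 2 and the square in `ClosedIdeal.norm_sub_op_smul_sq_le`.
  obtain ⟨e, he, hs, hn, hlt⟩ := I.exists_norm_sub_mul_lt hx (star_rinner x x)
    (show 0 < ε ^ 2 / 2 by positivity)
  refine ⟨_, ⟨e, he, hs, rfl⟩, ?_⟩
  rw [dist_eq_norm]
  refine lt_of_pow_lt_pow_left₀ 2 hε.le ?_
  linarith [ClosedIdeal.norm_sub_op_smul_sq_le x hs hn]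

/-- With p = ⟨x|x⟩, pairing x·p = 0 with x gives p*p = 0, hence p = 0. -/
theorem eq_zero_of_op_smul_self {x : X} (h : op (rinner A x x) • x = 0) : x = 0 := by
  have h1 : star (rinner A x x) * rinner A x x = 0 := by
    rw [star_rinner, ← rinner_op_smul_right, h, rinner_zero_right]
  have h2 := CStarRing.star_mul_self_eq_zero_iff _ |>.1 h1
  rw [← norm_eq_zero, norm_rinner_self, sq_eq_zero_iff, norm_eq_zero] at h2
  exact h2

/-! ### Rank-one operators -/

variable [CompleteSpace X]

theorem rinner_star_right (T : LOp A X) (x y : X) :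
    rinner A x (star T y) = rinner A (T x) y := rinner_eq_iff.2 (T.inner_star_right x y)

theorem theta_add_left (x x' y : X) : theta A (x + x') y = theta A x y + theta A x' y :=
  LOp.ext fun _ => op_smul_add _ _ _

theorem theta_smul_left (c : ℂ) (x y : X) : theta A (c • x) y = c • theta A x y :=
  LOp.ext fun _ => op_smul_smul _ _ _

theorem theta_op_smul_left (x y : X) (a : A) :
    theta A (op a • x) y = theta A x (op (star a) • y) :=
  LOp.ext fun z => by
    rw [theta_apply, theta_apply, rinner_op_smul_left, star_star, op_mul_smul]

theorem norm_theta_le (x y : X) : ‖theta A x y‖ ≤ ‖x‖ * ‖y‖ := by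
  rw [LOp.norm_def]
  refine ContinuousLinearMap.opNorm_le_bound _ (by positivity) fun z => ?_
  change ‖op (rinner A y z) • x‖ ≤ _
  calc _ ≤ ‖rinner A y z‖ * ‖x‖ := norm_op_smul_le (op (rinner A y z)) x
    _ ≤ (‖y‖ * ‖z‖) * ‖x‖ := by gcongr; exact norm_rinner_le _ _
    _ = _ := by ring

/-- The map `x ↦ Θ_{x,y}` as a bounded operator. -/
def thetaL (y : X) : X →L[ℂ] LOp A X :=
  LinearMap.mkContinuous
    { toFun := fun x => theta A x y
      map_add' := fun x x' => theta_add_left x x' y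
      map_smul' := fun c x => theta_smul_left c x y } ‖y‖ fun x => by
    rw [mul_comm]; exact norm_theta_le x y

theorem continuous_theta_left (y : X) : Continuous fun x => theta A x y := (thetaL y).continuous

/-- It suffices that one leg lie in X·I: x·a is a limit of vectors x·a·e with e in I self-adjoint,
and each e can be moved onto the other leg y. -/
theorem theta_op_smul_mem {I : ClosedIdeal A} {a : A} (ha : a ∈ I) (x y : X) :
    theta A (op a • x) y ∈ thetaSpan A (smulIdeal X I) := by
  have h : rinner A (op a • x) (op a • x) ∈ I := by
    rw [rinner_op_smul_right]; exact I.mul_mem_left _ ha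
  refine closure_minimal (t := {z | theta A z y ∈ thetaSpan A (smulIdeal X I)}) ?_
    ((isClosed_thetaSpan _).preimage (continuous_theta_left y)) (mem_closure_op_smul I h)
  rintro _ ⟨e, he, hs, rfl⟩
  change theta A (op e • op a • x) y ∈ thetaSpan A (smulIdeal X I)
  rw [theta_op_smul_left, hs]
  exact theta_mem ⟨x, a, ha, rfl⟩ ⟨y, e, he, rfl⟩

theorem LOp.continuous_apply (x : X) : Continuous fun T : LOp A X => T x :=
  (ContinuousLinearMap.apply ℂ X x).continuous.comp continuous_subtype_val

theorem rinner_mem_of_mem_thetaSpan {I : ClosedIdeal A} {T : LOp A X}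
    (hT : T ∈ thetaSpan A (smulIdeal X I)) (x y : X) : rinner A x (T y) ∈ I := by
  refine thetaSpan_induction (p := fun T => rinner A x (T y) ∈ I)
    (I.isClosed.preimage ((continuous_rinner_right x).comp (LOp.continuous_apply y)))
    ?_ ?_ ?_ ?_ hT
  · rw [LOp.zero_apply, rinner_zero_right]; exact I.zero_mem
  · intro S T hS hT; rw [LOp.add_apply, rinner_add_right]; exact I.add_mem hS hT
  · intro c T hT; rw [LOp.smul_apply, rinner_smul_right]; exact I.smul_mem c hT
  · rintro _ ⟨z, a, ha, rfl⟩ w -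
    rw [theta_apply, rinner_op_smul_right, rinner_op_smul_right]
    exact I.mul_mem_right _ (I.mul_mem_left _ ha)

/-! ### Compact operators and their coefficients -/

variable (A) in
/-- `Θ_{x,y}` as an element of `K_A(X)`. -/
def ktheta (x y : X) : KOp A X := ⟨theta A x y, theta_mem (Set.mem_univ x) (Set.mem_univ y)⟩

theorem incl_ktheta (x y : X) : KOp.incl (ktheta A x y) = theta A x y := rfl

/-- The inclusion into L_A(X) is a closed embedding, so a closed predicate has closed image there
and `thetaSpan_induction` applies to that image. -/
theorem KOp_induction {p : KOp A X → Prop} (hp : IsClosed {K | p K}) (h0 : p 0)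
    (hadd : ∀ K K', p K → p K' → p (K + K')) (hsmul : ∀ (z : ℂ) K, p K → p (z • K))
    (hθ : ∀ x y, p (ktheta A x y)) (K : KOp A X) : p K := by
  have hemb : Topology.IsClosedEmbedding (KOp.incl : KOp A X → LOp A X) :=
    (inferInstance : IsClosed (compacts A X : Set (LOp A X))).isClosedEmbedding_subtypeVal
  have hcl : IsClosed {T : LOp A X | ∃ K : KOp A X, p K ∧ KOp.incl K = T} :=
    hemb.isClosedMap _ hp
  obtain ⟨K', h, h'⟩ : ∃ K' : KOp A X, p K' ∧ KOp.incl K' = KOp.incl K := by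
    refine thetaSpan_induction (S := Set.univ)
      (p := fun T => ∃ K : KOp A X, p K ∧ KOp.incl K = T) hcl ⟨0, h0, map_zero _⟩ ?_ ?_ ?_ K.2
    · rintro _ _ ⟨K, h, rfl⟩ ⟨K', h', rfl⟩; exact ⟨_, hadd _ _ h h', map_add _ _ _⟩
    · rintro z _ ⟨K, h, rfl⟩; exact ⟨_, hsmul z _ h, map_smul _ _ _⟩
    · intro x _ y _; exact ⟨_, hθ x y, rfl⟩
  rwa [← KOp.ext h']

/-- Between two rank-one operators, only a single coefficient of T survives; the ideal
correspondence rests on this. -/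
theorem theta_mul_mul_theta (T : LOp A X) (x y z w : X) :
    theta A x y * T * theta A z w = theta A (op (rinner A y (T z)) • x) w := by
  rw [mul_assoc, mul_theta, mul_theta, theta_apply]

/-- An approximate unit reduces membership of K to that of all S K S'. Each outer factor is then
replaced by rank-one operators, whose span is dense. -/
theorem mem_of_forall_ktheta_mul_mul_ktheta_mem {J : ClosedIdeal (KOp A X)} {K : KOp A X}
    (h : ∀ x y z w, ktheta A x y * K * ktheta A z w ∈ J) : K ∈ J := by
  refine mem_of_forall_mul_mul_mem J.isClosed fun S S' => ?_
  refine KOp_induction (p := fun S' => S * K * S' ∈ J)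
    (J.isClosed.preimage (continuous_const_mul (S * K))) ?_ ?_ ?_ (fun z w => ?_) S'
  · rw [mul_zero]; exact J.zero_mem
  · intro T T' h h'; rw [mul_add]; exact J.add_mem h h'
  · intro c T h; rw [mul_smul_comm]; exact J.smul_mem c h
  refine KOp_induction (p := fun S => S * K * ktheta A z w ∈ J)
    (J.isClosed.preimage (by fun_prop)) ?_ ?_ ?_ (fun x y => h x y z w) S
  · rw [zero_mul, zero_mul]; exact J.zero_mem
  · intro T T' h h'; rw [add_mul, add_mul]; exact J.add_mem h h'
  · intro c T h; rw [smul_mul_assoc, smul_mul_assoc]; exact J.smul_mem c h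

/-- For the converse, compressing K between rank-one operators yields Θ_{x·⟨y|Kz⟩, w}, which lies in
K_A(X·I) once the coefficient is in I. -/
theorem mem_compactsIdeal_iff {I : ClosedIdeal A} {K : KOp A X} :
    K ∈ compactsIdeal X I ↔ ∀ x y, rinner A x (KOp.incl K y) ∈ I := by
  refine ⟨fun h x y => rinner_mem_of_mem_thetaSpan h x y, fun h => ?_⟩
  refine mem_of_forall_ktheta_mul_mul_ktheta_mem fun x y z w => ?_
  change KOp.incl (ktheta A x y * K * ktheta A z w) ∈ thetaSpan A (smulIdeal X I)
  rw [map_mul, map_mul, incl_ktheta, incl_ktheta, theta_mul_mul_theta]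
  exact theta_op_smul_mem (h y z) x w

theorem continuous_op_smul_left (x : X) : Continuous fun a : A => op a • x := by
  let f : A →ₗ[ℂ] X :=
    { toFun := fun a => op a • x
      map_add' := fun a b => add_op_smul (op a) (op b) x
      map_smul' := fun c a => smul_op_smul (op a) c x }
  exact (f.mkContinuous ‖x‖ fun a => by
    rw [mul_comm]; exact norm_op_smul_le (op a) x).continuous

/-! ### The correspondence between ideals of A and ideals of the compact operators -/

variable (X) in
/-- The ideal `{a | Θ_{x·a,y} ∈ J for all x, y}` of `A` attached to an ideal `J` of `K_A(X)`. -/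
def coefficientIdeal (J : ClosedIdeal (KOp A X)) : ClosedIdeal A where
  carrier := {a | ∀ x y : X, ktheta A (op a • x) y ∈ J}
  add_mem' {a b} ha hb x y := by
    have : ktheta A (op (a + b) • x) y = ktheta A (op a • x) y + ktheta A (op b • x) y :=
      KOp.ext (by rw [map_add, incl_ktheta, op_add, add_op_smul, theta_add_left]; rfl)
    rw [this]
    exact J.add_mem (ha x y) (hb x y)
  zero_mem' x y := by
    have : ktheta A (op (0 : A) • x) y = 0 := KOp.ext (by
      -- The algebra acts through a bare `SMul`, so that zero acts as zero is deduced from the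
      -- complex scalar 0.
      have h := smul_op_smul (op (0 : A)) (0 : ℂ) x
      rw [zero_smul, zero_smul] at h
      rw [map_zero, incl_ktheta, op_zero, h]
      exact map_zero (thetaL y))
    rw [this]
    exact J.zero_mem
  smul_mem' c a ha x y := by
    have : ktheta A (op (c • a) • x) y = c • ktheta A (op a • x) y :=
      KOp.ext (by rw [map_smul, incl_ktheta, op_smul, smul_op_smul, theta_smul_left]; rfl)
    rw [this]
    exact J.smul_mem c (ha x y)
  mul_mem_left' a b hb x y := by
    rw [op_mul_smul]
    exact hb _ y
  mul_mem_right' {b} a hb x y := by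
    -- In x·(ba) the factor a acts last, so it can be moved to the second leg as `star a`; in the
    -- case of left multiplication the extra factor is absorbed into x.
    have : ktheta A (op (b * a) • x) y = ktheta A (op b • x) (op (star a) • y) :=
      KOp.ext (by rw [incl_ktheta, op_mul_smul, theta_op_smul_left]; rfl)
    rw [this]
    exact hb x _
  isClosed' := by
    have h : IsClosed (⋂ (x : X) (y : X), (fun a : A => ktheta A (op a • x) y) ⁻¹' J) :=
      isClosed_iInter fun x => isClosed_iInter fun y => J.isClosed.preimage
        (((continuous_theta_left y).comp (continuous_op_smul_left x)).subtype_mk _)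
    convert h
    ext a
    simp only [Set.mem_iInter]
    rfl

/-- By the compression identity, the coefficients of K lie in the coefficient ideal iff every
Θ_{z,x} K Θ_{y,w} lies in J, which is equivalent to K lying in J. -/
theorem compactsIdeal_coefficientIdeal (J : ClosedIdeal (KOp A X)) :
    compactsIdeal X (coefficientIdeal X J) = J := by
  ext K
  rw [mem_compactsIdeal_iff]
  have key (x y z w : X) : ktheta A (op (rinner A x (KOp.incl K y)) • z) w =
      ktheta A z x * K * ktheta A y w :=
    KOp.ext (by rw [map_mul, map_mul, incl_ktheta, incl_ktheta, incl_ktheta, theta_mul_mul_theta])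
  constructor
  · intro h
    refine mem_of_forall_ktheta_mul_mul_ktheta_mem fun x y z w => ?_
    rw [← key]
    exact h y z x w
  · intro h x y z w
    rw [key]
    exact J.mul_mem_right _ (J.mul_mem_left _ h)

theorem IsFull.induction (hX : IsFull A X) {p : A → Prop} (hp : IsClosed {a | p a}) (h0 : p 0)
    (hadd : ∀ a b, p a → p b → p (a + b)) (hsmul : ∀ (c : ℂ) a, p a → p (c • a))
    (h : ∀ x y : X, p (rinner A x y)) (a : A) : p a := by
  refine closure_minimal (fun b hb => ?_) hp (hX a)
  refine Submodule.span_induction ?_ h0 (fun _ _ _ _ => hadd _ _) (fun c _ _ => hsmul c _) hb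
  rintro _ ⟨x, y, rfl⟩
  exact h x y

/-- Fullness lets sums of inner products approximate the outer factors c and d in
`mem_of_forall_mul_mul_mem`. -/
theorem IsFull.mem_of_forall (hX : IsFull A X) {I : ClosedIdeal A} {a : A}
    (h : ∀ x y z w : X, rinner A x y * a * rinner A z w ∈ I) : a ∈ I := by
  refine mem_of_forall_mul_mul_mem I.isClosed fun c d => ?_
  refine hX.induction (p := fun d => c * a * d ∈ I) (I.isClosed.preimage (by fun_prop))
    ?_ ?_ ?_ (fun z w => ?_) d
  · rw [mul_zero]; exact I.zero_mem
  · intro _ _ h h'; rw [mul_add]; exact I.add_mem h h'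
  · intro _ _ h; rw [mul_smul_comm]; exact I.smul_mem _ h
  refine hX.induction (p := fun c => c * a * rinner A z w ∈ I) (I.isClosed.preimage (by fun_prop))
    ?_ ?_ ?_ (fun x y => h x y z w) c
  · rw [zero_mul, zero_mul]; exact I.zero_mem
  · intro _ _ h h'; rw [add_mul, add_mul]; exact I.add_mem h h'
  · intro _ _ h; rw [smul_mul_assoc, smul_mul_assoc]; exact I.smul_mem _ h

/-- The coefficients of Θ_{y·a,z} are the products ⟨x|y⟩ a ⟨z|w⟩, and by fullness these detect
whether a is in I. -/
theorem IsFull.coefficientIdeal_compactsIdeal (hX : IsFull A X) (I : ClosedIdeal A) :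
    coefficientIdeal X (compactsIdeal X I) = I := by
  ext a
  constructor
  · intro h
    refine hX.mem_of_forall fun x y z w => ?_
    have := mem_compactsIdeal_iff.1 (h y z) x w
    rwa [incl_ktheta, theta_apply, rinner_op_smul_right, rinner_op_smul_right] at this
  · intro h x y
    exact theta_op_smul_mem h x y

theorem compactsIdeal_mono {I J : ClosedIdeal A} (h : I ≤ J) :
    compactsIdeal X I ≤ compactsIdeal X J := fun _ hK =>
  mem_compactsIdeal_iff.2 fun x y => h (mem_compactsIdeal_iff.1 hK x y)

theorem coefficientIdeal_mono {I J : ClosedIdeal (KOp A X)} (h : I ≤ J) :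
    coefficientIdeal X I ≤ coefficientIdeal X J := fun _ ha x y => h (ha x y)

/-- The lattice isomorphism between the ideals of `A` and the ideals of `K_A(X)` induced by a full
Hilbert module. -/
def IsFull.idealIso (hX : IsFull A X) : ClosedIdeal A ≃o ClosedIdeal (KOp A X) where
  toFun := compactsIdeal X
  invFun := coefficientIdeal X
  left_inv := hX.coefficientIdeal_compactsIdeal
  right_inv := compactsIdeal_coefficientIdeal
  map_rel_iff' {I J} := by
    refine ⟨fun h => ?_, compactsIdeal_mono⟩
    rw [← hX.coefficientIdeal_compactsIdeal I, ← hX.coefficientIdeal_compactsIdeal J]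
    exact coefficientIdeal_mono h

theorem IsFull.idealIso_apply (hX : IsFull A X) (I : ClosedIdeal A) :
    hX.idealIso I = compactsIdeal X I := rfl

/-! ### The multiplier algebra of the compact operators -/

/-- If S acts as zero, then S Θ_{x,Sx} = Θ_{Sx,Sx} vanishes; evaluating at Sx gives Sx·⟨Sx|Sx⟩ = 0,
so Sx = 0. -/
theorem toMultiplier_injective : Function.Injective (toMultiplier (A := A) (X := X)) := by
  refine (injective_iff_map_eq_zero _).2 fun S hS => LOp.ext fun x => ?_
  have h : S * KOp.incl (ktheta A x (S x)) = 0 := by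
    rw [← toMultiplier_fst, hS]; rfl
  rw [incl_ktheta, mul_theta] at h
  have h' := congrArg (fun T : LOp A X => T (S x)) h
  exact eq_zero_of_op_smul_self (A := A) h'

theorem toMultiplier_incl (K : KOp A X) :
    toMultiplier (KOp.incl K) = (K : 𝓜(ℂ, KOp A X)) :=
  DoubleCentralizer.ext _ _ _ _ (Prod.ext (by ext1; rfl) (by ext1; rfl))

end Modules

section Tensor

variable {C B Y : Type*} [NonUnitalCStarAlgebra C]
  [NonUnitalCStarAlgebra B] [PartialOrder B] [StarOrderedRing B]
  [NormedAddCommGroup Y] [NormedSpace ℂ Y] [SMul Bᵐᵒᵖ Y] [CStarModule Bᵐᵒᵖ Y] [CompleteSpace Y]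

/-- Faithfulness of L_B(Y) → M(K_B(Y)) replaces multipliers by operators: the Pimsner ideal consists
of the elements acting compactly. -/
theorem mem_pim_toMor {φ : C →⋆ₙₐ[ℂ] LOp B Y} {c : C} :
    c ∈ pim (toMor φ) ↔ φ c ∈ compacts B Y := by
  constructor
  · rintro ⟨K, hK⟩
    have : φ c = KOp.incl K := toMultiplier_injective (hK.trans (toMultiplier_incl K).symm)
    rw [this]
    exact K.2
  · intro h
    exact ⟨⟨φ c, h⟩, toMultiplier_incl ⟨φ c, h⟩⟩

theorem mem_ker_toMor {φ : C →⋆ₙₐ[ℂ] LOp B Y} {c : C} : c ∈ ker (toMor φ) ↔ φ c = 0 :=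
  map_eq_zero_iff _ toMultiplier_injective

end Tensor

/-! ### Adjointable operators between different modules -/

section Adjoints

variable {B Y Z : Type*} [NonUnitalCStarAlgebra B] [PartialOrder B] [StarOrderedRing B]
  [NormedAddCommGroup Y] [NormedSpace ℂ Y] [SMul Bᵐᵒᵖ Y] [CStarModule Bᵐᵒᵖ Y]
  [NormedAddCommGroup Z] [NormedSpace ℂ Z] [SMul Bᵐᵒᵖ Z] [CStarModule Bᵐᵒᵖ Z]

variable (B Y Z) in
/-- A bounded operator between Hilbert modules together with its adjoint. -/
structure AdjointPair where
  /-- the operator -/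
  op : Y →L[ℂ] Z
  /-- its adjoint -/
  adj : Z →L[ℂ] Y
  rinner_op_left : ∀ y z, rinner B (op y) z = rinner B y (adj z)

namespace AdjointPair

theorem rinner_op_right (P : AdjointPair B Y Z) (z : Z) (y : Y) :
    rinner B z (P.op y) = rinner B (P.adj z) y := by
  rw [← star_rinner, P.rinner_op_left, star_rinner]

/-- The adjoint pair. -/
def symm (P : AdjointPair B Y Z) : AdjointPair B Z Y where
  op := P.adj
  adj := P.op
  rinner_op_left z y := (P.rinner_op_right z y).symm

theorem op_op_smul (P : AdjointPair B Y Z) (b : Bᵐᵒᵖ) (y : Y) : P.op (b • y) = b • P.op y := by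
  refine ext_rinner B fun z => ?_
  rw [← op_unop b, rinner_op_smul_right, rinner_op_right, rinner_op_right, rinner_op_smul_right]

variable [CompleteSpace Y] [CompleteSpace Z]

/-- The map `S ↦ P S Q`. -/
def sandwich (P : AdjointPair B Y Z) (Q : AdjointPair B Z Y) : LOp B Y →L[ℂ] LOp B Z :=
  LinearMap.mkContinuous
    { toFun := fun S => ⟨P.op ∘L S.toCLM ∘L Q.op, Q.adj ∘L (star S).toCLM ∘L P.adj, fun z w => by
        change rinner B (P.op (S (Q.op z))) w = rinner B z (Q.adj (star S (P.adj w)))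
        rw [P.rinner_op_left, ← Q.rinner_op_left, rinner_star_right]⟩
      map_add' := fun S T => LOp.ext fun z => map_add P.op (S (Q.op z)) (T (Q.op z))
      map_smul' := fun c S => LOp.ext fun z => map_smul P.op c (S (Q.op z)) }
    (‖P.op‖ * ‖Q.op‖) fun S => by
      rw [LOp.norm_def, LOp.norm_def]
      calc _ ≤ ‖P.op‖ * (‖S.1‖ * ‖Q.op‖) := (ContinuousLinearMap.opNorm_comp_le _ _).trans
            (by gcongr; exact ContinuousLinearMap.opNorm_comp_le _ _)
        _ = _ := by ring

theorem sandwich_apply (P : AdjointPair B Y Z) (Q : AdjointPair B Z Y) (S : LOp B Y) (z : Z) :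
    P.sandwich Q S z = P.op (S (Q.op z)) := rfl

theorem sandwich_theta (P : AdjointPair B Y Z) (Q : AdjointPair B Z Y) (y y' : Y) :
    P.sandwich Q (theta B y y') = theta B (P.op y) (Q.adj y') :=
  LOp.ext fun z => by
    rw [sandwich_apply, theta_apply, theta_apply, P.op_op_smul, Q.rinner_op_right]

/-- S ↦ P S Q is linear and continuous, and takes rank-one operators to rank-one operators, even
though Y and Z differ. -/
theorem sandwich_mem_compacts (P : AdjointPair B Y Z) (Q : AdjointPair B Z Y) {S : LOp B Y}
    (hS : S ∈ compacts B Y) : P.sandwich Q S ∈ compacts B Z := by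
  refine thetaSpan_induction (S := Set.univ) (p := fun S => P.sandwich Q S ∈ compacts B Z)
    ((isClosed_thetaSpan _).preimage (P.sandwich Q).continuous) ?_ ?_ ?_ ?_ hS
  · rw [map_zero]; exact zero_mem _
  · intro S T h h'; rw [map_add]; exact add_mem h h'
  · intro c S h; rw [map_smul]; exact Submodule.smul_mem (thetaSpan B Set.univ) c h
  · intro y _ y' _
    rw [sandwich_theta]
    exact theta_mem (Set.mem_univ _) (Set.mem_univ _)

end AdjointPair

end Adjoints

/-! ### Creation operators on the interior tensor product -/

section Tensor

variable {A B X Y : Type*}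
  [NonUnitalCStarAlgebra A] [PartialOrder A] [StarOrderedRing A]
  [NonUnitalCStarAlgebra B] [PartialOrder B] [StarOrderedRing B]
  [NormedAddCommGroup X] [NormedSpace ℂ X] [SMul Aᵐᵒᵖ X] [CStarModule Aᵐᵒᵖ X] [CompleteSpace X]
  [NormedAddCommGroup Y] [NormedSpace ℂ Y] [SMul Bᵐᵒᵖ Y] [CStarModule Bᵐᵒᵖ Y] [CompleteSpace Y]
  (ψ : A →⋆ₙₐ[ℂ] LOp B Y)

theorem norm_map_apply_le (a : A) (y : Y) : ‖ψ a y‖ ≤ ‖a‖ * ‖y‖ :=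
  ((ψ a).1.le_opNorm y).trans (by gcongr; exact NonUnitalStarAlgHom.norm_apply_le ψ a)

theorem norm_tmul_le (x : X) (y : Y) : ‖tmul ψ x y‖ ≤ ‖x‖ * ‖y‖ := by
  refine le_of_sq_le_sq ?_ (by positivity)
  rw [← norm_rinner_self (A := B), inner_tmul]
  calc _ ≤ ‖y‖ * (‖rinner A x x‖ * ‖y‖) := (norm_rinner_le _ _).trans
        (by gcongr; exact norm_map_apply_le ψ _ y)
    _ = _ := by rw [norm_rinner_self]; ring

theorem tmul_add_right (x : X) (y y' : Y) : tmul ψ x (y + y') = tmul ψ x y + tmul ψ x y' := by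
  rw [tmul, TensorProduct.tmul_add, map_add, UniformSpace.Completion.coe_add]; rfl

theorem tmul_add_left (x x' : X) (y : Y) : tmul ψ (x + x') y = tmul ψ x y + tmul ψ x' y := by
  rw [tmul, TensorProduct.add_tmul, map_add, UniformSpace.Completion.coe_add]; rfl

theorem tmul_smul_right (c : ℂ) (x : X) (y : Y) : tmul ψ x (c • y) = c • tmul ψ x y := by
  rw [tmul, TensorProduct.tmul_smul, map_smul, UniformSpace.Completion.coe_smul]; rfl

theorem tmul_smul_left (c : ℂ) (x : X) (y : Y) : tmul ψ (c • x) y = c • tmul ψ x y := by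
  rw [tmul, ← TensorProduct.smul_tmul', map_smul, UniformSpace.Completion.coe_smul]; rfl

theorem continuous_tmul_left (y : Y) : Continuous fun x : X => tmul ψ x y := by
  let f : X →ₗ[ℂ] Tensor X ψ :=
    { toFun := fun x => tmul ψ x y
      map_add' := fun x x' => tmul_add_left ψ x x' y
      map_smul' := fun c x => tmul_smul_left ψ c x y }
  exact (f.mkContinuous ‖y‖ fun x => by rw [mul_comm]; exact norm_tmul_le ψ x y).continuous

/-- No hypothesis on scalar multiples is needed, since every algebraic tensor is a sum of elementary
ones. -/
theorem tensor_induction {p : Tensor X ψ → Prop} (hp : IsClosed {z | p z})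
    (h0 : p 0) (hadd : ∀ z w, p z → p w → p (z + w)) (h : ∀ x y, p (tmul ψ x y))
    (z : Tensor X ψ) : p z := by
  refine UniformSpace.Completion.induction_on z hp fun u => ?_
  obtain ⟨u, rfl⟩ := preMk_surjective ψ u
  induction u with
  | zero => rw [map_zero, UniformSpace.Completion.coe_zero]; exact h0
  | add u v hu hv => rw [map_add, UniformSpace.Completion.coe_add]; exact hadd _ _ hu hv
  | tmul x y => exact h x y

theorem tensor_clm_ext {E : Type*} [NormedAddCommGroup E] [NormedSpace ℂ E]
    {f g : Tensor X ψ →L[ℂ] E} (h : ∀ x y, f (tmul ψ x y) = g (tmul ψ x y)) : f = g :=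
  ContinuousLinearMap.ext fun z => tensor_induction ψ (p := fun z => f z = g z)
    (isClosed_eq f.continuous g.continuous) (by rw [map_zero, map_zero])
    (fun z w hz hw => by rw [map_add, map_add, hz, hw]) h z

/-- The balancing relation: both sides have the same inner product with every elementary tensor,
because ψ is multiplicative. -/
theorem tmul_op_smul (x : X) (a : A) (y : Y) : tmul ψ (op a • x) y = tmul ψ x (ψ a y) := by
  refine ext_rinner B fun w => ?_
  refine tensor_induction ψ
    (p := fun w => rinner B w (tmul ψ (op a • x) y) = rinner B w (tmul ψ x (ψ a y)))
    (isClosed_eq (continuous_rinner.comp (by fun_prop : Continuous fun w => (w, _)))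
      (continuous_rinner.comp (by fun_prop : Continuous fun w => (w, _)))) ?_ ?_ ?_ w
  · rw [← star_rinner, rinner_zero_right, ← star_rinner, rinner_zero_right]
  · intro z w hz hw
    rw [rinner_add_left, rinner_add_left, hz, hw]
  · intro x' y'
    rw [inner_tmul, inner_tmul, rinner_op_smul_right, map_mul]
    rfl

/-- The operator `x' ⊗ y ↦ ψ(⟨x | x'⟩) y` on the algebraic tensor product. -/
def algContract (x : X) : X ⊗[ℂ] Y →ₗ[ℂ] Y :=
  TensorProduct.lift (LinearMap.mk₂ ℂ (fun (x' : X) (y : Y) => ψ (rinner A x x') y)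
    (fun x₁ x₂ y => by rw [rinner_add_right, map_add]; rfl)
    (fun c x' y => by rw [rinner_smul_right, map_smul]; rfl)
    (fun x' y₁ y₂ => map_add _ _ _)
    (fun c x' y => map_smul _ _ _))

/-- The contraction is the formal adjoint of w ↦ x ⊗ w, which is why it kills null vectors and
descends to the quotient. -/
theorem inner_algContract (x : X) (w : Y) (z : X ⊗[ℂ] Y) :
    inner Bᵐᵒᵖ w (algContract ψ x z) = form X ψ (x ⊗ₜ w) z := by
  induction z with
  | zero => simp
  | add z z' h h' => simp [h, h']
  | tmul x' y' => rfl

/-- The operator `x' ⊗ y ↦ ψ(⟨x | x'⟩) y` on the quotient by null vectors. -/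
def preContract (x : X) : PreTensor X ψ →ₗ[ℂ] Y :=
  Submodule.liftQ (LinearMap.ker (form X ψ)) (algContract ψ x) fun z hz => by
    rw [LinearMap.mem_ker]
    refine ext_inner (C := Bᵐᵒᵖ) fun w => ?_
    rw [inner_algContract, ← star_form, LinearMap.mem_ker.1 hz, LinearMap.zero_apply, star_zero,
      CStarModule.inner_zero_right]

theorem rinner_preContract (x : X) (w : Y) (u : PreTensor X ψ) :
    rinner B w (preContract ψ x u) = rinner B (tmul ψ x w) (u : Tensor X ψ) := by
  obtain ⟨u, rfl⟩ := preMk_surjective ψ u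
  refine congrArg unop (?_ : inner Bᵐᵒᵖ w (algContract ψ x u) = inner Bᵐᵒᵖ (tmul ψ x w) _)
  rw [tmul, completion_inner_coe, inner_preMk, ← inner_algContract]

/-- A duality estimate: for the image y of u, ‖y‖² = ‖⟨x ⊗ y | u⟩‖ ≤ ‖x‖ ‖y‖ ‖u‖, and one factor ‖y‖
is cancelled. -/
theorem norm_preContract_le (x : X) (u : PreTensor X ψ) : ‖preContract ψ x u‖ ≤ ‖x‖ * ‖u‖ := by
  set y := preContract ψ x u with hy
  have h : ‖y‖ * ‖y‖ ≤ (‖x‖ * ‖u‖) * ‖y‖ := by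
    rw [← sq, ← norm_rinner_self (A := B)]
    nth_rewrite 2 [hy]
    rw [rinner_preContract]
    calc _ ≤ (‖x‖ * ‖y‖) * ‖(u : Tensor X ψ)‖ := (norm_rinner_le _ _).trans
          (by gcongr; exact norm_tmul_le ψ x y)
      _ = _ := by rw [UniformSpace.Completion.norm_coe]; ring
  rcases (norm_nonneg y).eq_or_lt with h0 | h0
  · rw [← h0]; positivity
  · exact le_of_mul_le_mul_right h h0

/-- The operator `x' ⊗ y ↦ ψ(⟨x | x'⟩) y`. -/
def contract (x : X) : Tensor X ψ →L[ℂ] Y :=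
  ((preContract ψ x).mkContinuous ‖x‖ (norm_preContract_le ψ x)).extend
    UniformSpace.Completion.toComplL

theorem contract_coe (x : X) (u : PreTensor X ψ) :
    contract ψ x (u : Tensor X ψ) = preContract ψ x u :=
  ContinuousLinearMap.extend_eq _ UniformSpace.Completion.denseRange_coe
    (UniformSpace.Completion.isUniformInducing_coe _) u

theorem contract_tmul (x x' : X) (y : Y) : contract ψ x (tmul ψ x' y) = ψ (rinner A x x') y :=
  contract_coe ψ x _

/-- The creation operator `y ↦ x ⊗ y` and its adjoint. -/
def creation (x : X) : AdjointPair B Y (Tensor X ψ) where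
  op := LinearMap.mkContinuous
    { toFun := fun y => tmul ψ x y
      map_add' := tmul_add_right ψ x
      map_smul' := fun c y => tmul_smul_right ψ c x y } ‖x‖ (norm_tmul_le ψ x)
  adj := contract ψ x
  rinner_op_left y z := by
    change rinner B (tmul ψ x y) z = rinner B y (contract ψ x z)
    refine UniformSpace.Completion.induction_on z (isClosed_eq (continuous_rinner_right _)
      ((continuous_rinner_right _).comp (contract ψ x).continuous)) fun u => ?_
    rw [contract_coe, rinner_preContract]

/-- Compressing T ⊗ 1 by creation operators gives ψ of a coefficient of T, so properties of T ⊗ 1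
pass to the coefficients. -/
theorem sandwich_tensorOne (T : LOp A X) (x x' : X) :
    (creation ψ x).symm.sandwich (creation ψ x') (tensorOne X ψ T) = ψ (rinner A x (T x')) :=
  LOp.ext fun y => by
    change contract ψ x (tensorOne X ψ T (tmul ψ x' y)) = _
    rw [tensorOne_tmul, contract_tmul]

/-- The opposite passage, from ψ(a) to rank-one operators tensored with 1; on elementary tensors it
is the balancing relation. -/
theorem tensorOne_theta_op_smul (x y : X) (a : A) :
    tensorOne X ψ (theta A (op a • x) y) =
      (creation ψ x).sandwich (creation ψ y).symm (ψ a) := by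
  refine Subtype.ext (tensor_clm_ext ψ fun x' y' => ?_)
  change tensorOne X ψ (theta A (op a • x) y) (tmul ψ x' y') =
    tmul ψ x (ψ a (contract ψ y (tmul ψ x' y')))
  rw [tensorOne_tmul, theta_apply, contract_tmul, tmul_op_smul, tmul_op_smul]

/-! ### The ideals attached to `λ` -/

theorem mem_pim_lam {K : KOp A X} :
    K ∈ pim (lam X ψ) ↔ tensorOne X ψ (KOp.incl K) ∈ compacts B (Tensor X ψ) :=
  mem_pim_toMor (φ := (tensorOne X ψ).comp KOp.incl)

theorem mem_ker_lam {K : KOp A X} :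
    K ∈ ker (lam X ψ) ↔ tensorOne X ψ (KOp.incl K) = 0 :=
  mem_ker_toMor (φ := (tensorOne X ψ).comp KOp.incl)

theorem continuous_tensorOne : Continuous (tensorOne X ψ) :=
  AddMonoidHomClass.continuous_of_bound (tensorOne X ψ) 1 fun T => by
    rw [one_mul]
    exact NonUnitalStarAlgHom.norm_apply_le _ T

/-- Each inclusion uses one of the two sandwich formulas, as sandwiching preserves compactness. -/
theorem pim_lam : pim (lam X ψ) = compactsIdeal X (pim (toMor ψ)) := by
  refine le_antisymm (fun K hK => mem_compactsIdeal_iff.2 fun x x' => ?_) fun K hK => ?_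
  · rw [mem_pim_toMor, ← sandwich_tensorOne]
    exact AdjointPair.sandwich_mem_compacts _ _ ((mem_pim_lam ψ).1 hK)
  · refine (mem_pim_lam ψ).2 ?_
    refine thetaSpan_induction (p := fun T => tensorOne X ψ T ∈ compacts B (Tensor X ψ))
      ((isClosed_thetaSpan _).preimage (continuous_tensorOne ψ)) ?_ ?_ ?_ ?_
      (show KOp.incl K ∈ thetaSpan A (smulIdeal X (pim (toMor ψ))) from hK)
    · rw [map_zero]; exact zero_mem _
    · intro S T h h'; rw [map_add]; exact add_mem h h'
    · intro c S h; rw [map_smul]; exact Submodule.smul_mem (thetaSpan B Set.univ) c h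
    · rintro _ ⟨x, a, ha, rfl⟩ y -
      rw [tensorOne_theta_op_smul]
      exact AdjointPair.sandwich_mem_compacts _ _ (mem_pim_toMor.1 ha)

theorem tensorOne_eq_zero_iff {T : LOp A X} :
    tensorOne X ψ T = 0 ↔ ∀ x x', ψ (rinner A x (T x')) = 0 := by
  refine ⟨fun h x x' => by rw [← sandwich_tensorOne, h, map_zero], fun h => ?_⟩
  refine Subtype.ext (tensor_clm_ext ψ fun x' y' => ?_)
  change tensorOne X ψ T (tmul ψ x' y') = 0
  -- The squared norm of Tx' ⊗ y' is the norm of ⟨y' | ψ(⟨Tx'|Tx'⟩) y'⟩; the hypothesis is used with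
  -- x = Tx'.
  rw [tensorOne_tmul, ← norm_eq_zero, ← sq_eq_zero_iff, ← norm_rinner_self (A := B), inner_tmul, h,
    LOp.zero_apply, rinner_zero_right, norm_zero]

theorem ker_lam : ker (lam X ψ) = compactsIdeal X (ker (toMor ψ)) := by
  refine ClosedIdeal.ext fun K => (mem_ker_lam ψ).trans ((tensorOne_eq_zero_iff ψ).trans ?_)
  refine Iff.trans ?_ mem_compactsIdeal_iff.symm
  simp only [mem_ker_toMor]

/-! ### λ is a morphism -/

theorem IsFull.dense_theta_apply (hX : IsFull A X) {S : Submodule ℂ X} (hS : IsClosed (S : Set X))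
    (h : ∀ x y z : X, theta A x y z ∈ S) (x : X) : x ∈ S := by
  -- With I = A the membership condition of `mem_closure_op_smul` is vacuous, so every x is a limit
  -- of vectors x·a.
  let T : ClosedIdeal A :=
    { (⊤ : Submodule ℂ A) with
      mul_mem_left' := fun _ _ _ => trivial
      mul_mem_right' := fun _ _ => trivial
      isClosed' := isClosed_univ }
  refine closure_minimal ?_ hS (mem_closure_op_smul T (show rinner A x x ∈ T from trivial))
  rintro _ ⟨a, -, -, rfl⟩
  -- By fullness a may be taken to be an inner product, and x·⟨y|z⟩ = Θ_{x,y} z.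
  refine hX.induction (p := fun a => op a • x ∈ S) (hS.preimage (continuous_op_smul_left x))
    ?_ ?_ ?_ (fun y z => h x y z) a
  · have h0 := smul_op_smul (op (0 : A)) (0 : ℂ) x
    rw [zero_smul, zero_smul] at h0
    rw [op_zero, h0]
    exact S.zero_mem
  · intro a b ha hb; rw [op_add, add_op_smul]; exact S.add_mem ha hb
  · intro c a ha; rw [op_smul, smul_op_smul]; exact S.smul_mem c ha

/-- Since λ(Θ) Θ_{x⊗y,w} = Θ_{Θx⊗y,w} and the vectors Θx span a dense subspace of X, the products
λ(K)L generate every rank-one operator on X ⊗_A Y. -/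
theorem isMorphism_lam (hX : IsFull A X) : IsMorphism (lam X ψ) := by
  refine isMorphism_of_forall_closed_submodule fun S hS hmem => ?_
  have hcont (w : Tensor X ψ) : Continuous fun z => ktheta B z w :=
    (continuous_theta_left w).subtype_mk _
  have hzero (w : Tensor X ψ) : ktheta B 0 w = 0 := KOp.ext (map_zero (thetaL w))
  have hadd (z z' w : Tensor X ψ) : ktheta B (z + z') w = ktheta B z w + ktheta B z' w :=
    KOp.ext (theta_add_left z z' w)
  have hsmul (c : ℂ) (z w : Tensor X ψ) : ktheta B (c • z) w = c • ktheta B z w :=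
    KOp.ext (theta_smul_left c z w)
  have key (x : X) (y : Y) (w : Tensor X ψ) : ktheta B (tmul ψ x y) w ∈ S := by
    -- For fixed y and w, the admissible x form a closed subspace; containing every Θ_{x₁,x₂} x₃, it
    -- is all of X.
    let R : Submodule ℂ X :=
      { carrier := {x | ktheta B (tmul ψ x y) w ∈ S}
        add_mem' := fun {x x'} h h' => by
          change ktheta B (tmul ψ (x + x') y) w ∈ S
          rw [tmul_add_left, hadd]
          exact S.add_mem h h'
        zero_mem' := by
          change ktheta B (tmul ψ 0 y) w ∈ S
          have : tmul ψ (0 : X) y = 0 := by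
            simpa only [zero_smul] using tmul_smul_left ψ 0 (0 : X) y
          rw [this, hzero]
          exact S.zero_mem
        smul_mem' := fun c x h => by
          change ktheta B (tmul ψ (c • x) y) w ∈ S
          rw [tmul_smul_left, hsmul]
          exact S.smul_mem c h }
    refine hX.dense_theta_apply (S := R) (hS.preimage ((hcont w).comp (continuous_tmul_left ψ y)))
      (fun x₁ x₂ x₃ => ?_) x
    have h : ktheta B (tmul ψ (theta A x₁ x₂ x₃) y) w =
        (lam X ψ (ktheta A x₁ x₂)).fst (ktheta B (tmul ψ x₃ y) w) := KOp.ext (by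
      refine Eq.trans ?_ (toMultiplier_fst (tensorOne X ψ (theta A x₁ x₂)) _).symm
      rw [incl_ktheta, incl_ktheta, mul_theta, tensorOne_tmul])
    change ktheta B (tmul ψ (theta A x₁ x₂ x₃) y) w ∈ S
    rw [h]
    exact hmem _ _
  intro K
  refine KOp_induction (p := fun K => K ∈ S) hS S.zero_mem (fun _ _ => S.add_mem)
    (fun c _ => S.smul_mem c) (fun z w => ?_) K
  refine tensor_induction ψ (p := fun z => ktheta B z w ∈ S) (hS.preimage (hcont w)) ?_ ?_
    (fun x y => key x y w) z
  · rw [hzero]; exact S.zero_mem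
  · intro z z' h h'; rw [hadd]; exact S.add_mem h h'

/-! ### Annihilator of the kernel and Katsura ideal of λ -/

theorem annihilator_ker_lam (hX : IsFull A X) :
    (ker (lam X ψ)).annihilator = compactsIdeal X (ker (toMor ψ)).annihilator := by
  rw [ker_lam]
  exact (hX.idealIso.map_annihilator _).symm

/-- The Katsura ideal is a meet of two ideals already matched, and the lattice isomorphism preserves
meets. -/
theorem kat_lam (hX : IsFull A X) : kat (lam X ψ) = compactsIdeal X (kat (toMor ψ)) := by
  have h : kat (lam X ψ) = pim (lam X ψ) ⊓ (ker (lam X ψ)).annihilator := rfl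
  rw [h, pim_lam, annihilator_ker_lam ψ hX]
  exact (hX.idealIso.map_inf _ _).symm

end Tensor

end HilbertCorr

end

/-! ### The proposition -/

theorem mainTheorem12 {A B X Y : Type*}
    [NonUnitalCStarAlgebra A] [PartialOrder A] [StarOrderedRing A]
    [NonUnitalCStarAlgebra B] [PartialOrder B] [StarOrderedRing B]
    [NormedAddCommGroup X] [NormedSpace ℂ X] [SMul Aᵐᵒᵖ X] [CStarModule Aᵐᵒᵖ X] [CompleteSpace X]
    [NormedAddCommGroup Y] [NormedSpace ℂ Y] [SMul Bᵐᵒᵖ Y] [CStarModule Bᵐᵒᵖ Y] [CompleteSpace Y]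
    (hX : IsFull A X) (ψ : A →⋆ₙₐ[ℂ] LOp B Y) (hψ : IsNondegenerate ψ) :
    IsMorphism (lam X ψ) ∧
    pim (lam X ψ) = compactsIdeal X (pim (toMor ψ)) ∧
    ker (lam X ψ) = compactsIdeal X (ker (toMor ψ)) ∧
    (ker (lam X ψ)).annihilator = compactsIdeal X (ker (toMor ψ)).annihilator ∧
    kat (lam X ψ) = compactsIdeal X (kat (toMor ψ)) ∧
    IsSublattice {I | IsProperFor (toMor ψ) I} ∧
    IsSublattice {J | IsProperFor (lam X ψ) J} ∧
    IsSublattice {I | IsPerfectFor (toMor ψ) I} ∧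
    IsSublattice {J | IsPerfectFor (lam X ψ) J} ∧
    ∃ e : ClosedIdeal A ≃o ClosedIdeal (KOp A X),
      (∀ I, e I = compactsIdeal X I) ∧
      e '' {I | IsProperFor (toMor ψ) I} = {J | IsProperFor (lam X ψ) J} ∧
      e '' {I | IsPerfectFor (toMor ψ) I} = {J | IsPerfectFor (lam X ψ) J} := by
  exact ⟨isMorphism_lam ψ hX, pim_lam ψ, ker_lam ψ, annihilator_ker_lam ψ hX, kat_lam ψ hX,
    isSublattice_isProperFor _, isSublattice_isProperFor _, isSublattice_isPerfectFor _,
    isSublattice_isPerfectFor _, hX.idealIso, hX.idealIso_apply,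
    image_isProperFor hX.idealIso (pim_lam ψ), image_isPerfectFor hX.idealIso (kat_lam ψ hX)⟩
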